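/- **Conventions.** Monoids are commutative; $\overline M=M/M^\times$ for a monoid (or sheaf of monoids) $M$. An fs monoid is a finitely generated saturated monoid (in particular integral, i.e. cancellative). An *fs log analytic space* is a complex analytic space $X$ with a log structure $\alpha\colon M_X\to\mathcal O_X$ which locally is associated with a homomorphism from an fs monoid. Its log structure is *free* if every stalk $\overline M_{X,x}$ is isomorphic to $\mathbb N^r$ for some $r\ge 0$. A *free log point* is an fs log analytic space with free log structure whose underlying analytic space is $\operatorname{Spec}\mathbb C$. Let $f\colon X\to S$ be a morphism of fs log analytic spaces. - $f$ is *log smooth* if, for every strict closed immersion $T_0\to T$ of fs log analytic spaces defined by an ideal of square zero and every commutative square formed by it, $f$ and morphisms $T_0\to X$, $T\to S$, there exists, locally on $T$, a morphism $T\to X$ making both triangles commute. - $f$ is *vertical* if for every $x\in X$ the quotient monoid of $\overline M_{X,x}$ by the image of $\overline M_{S,f(x)}$ is a group. - A homomorphism $h\colon P\to Q$ of integral monoids is *integral* if whenever $h(a_1)b_1=h(a_2)b_2$ with $a_i\in P$, $b_i\in Q$, there are $a_3,a_4\in P$ and $b\in Q$ with $b_1=h(a_3)b$, $b_2=h(a_4)b$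 and $a_1a_3=a_2a_4$. A homomorphism $h\colon P\to Q$ of saturated monoids is *saturated* if it is integral and, for every homomorphism $P\to P'$ to a saturated monoid, the pushout $P'\oplus_PQ$ is a saturated monoid. The morphism $f$ is *saturated* if $\overline M_{S,f(x)}\to\overline M_{X,x}$ is saturated for every $x\in X$. - If $S$ is a free log point, $f$ is a *semistable log smooth degeneration* if it is log smooth, the log structure of $X$ is free, and for every $x\in X$ the homomorphism $\overline M_{S,f(x)}\to\overline M_{X,x}$ is isomorphic to a product of diagonal maps $\mathbb N\to\mathbb N^{s}$, $1\mapsto(1,\dots,1)$, for various $s$. - In general, $f$ is *semistable* if $f$ is log smooth, the log structure of $S$ is free, and every fibre of $f$ is a semistable log smooth degeneration. Here the fibre over $s\in S$ is the fibre product $X\times_S s\to s$, where $s$ is the one-point analytic space $\operatorname{Spec}\mathbb C$ with the pullback of the log structure of $S$. **Proposition.** A morphism $f\colon X\to S$ of fs log analytic spaces is semistable if and only if $f$ is vertical, saturated and log smooth, and the log structures of $X$ and $S$ are free. **Lemma.** Let $r\ge 1$ and $m\ge 0$. A homomorphism $h\colon\mathbb N^r\to\mathbb N^m$ is integral if and only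 if it is isomorphic to the product of $r$ homomorphisms $\mathbb N\to\mathbb N^{s(i)}$ $(1\le i\le r)$ with $m=\sum_i s(i)$. -/

import Mathlib

open CategoryTheory TopologicalSpace Topology

universe u

/-! ## Monoids

All monoids are commutative and written multiplicatively; `Associates M` is Mathlib's quotient
`M / Mˣ` of a commutative monoid by its group of units, and `Multiplicative (Fin r → ℕ)` is `ℕ^r`. -/

/-- The congruence defining the amalgamated sum, generated by `(a r, 1) ∼ (1, b r)`. -/
def amalgamCon {R P Q : Type*} [CommMonoid R] [CommMonoid P] [CommMonoid Q]
    (a : R →* P) (b : R →* Q) : Con (P × Q) :=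
  conGen fun x y => ∃ r : R, x = (a r, 1) ∧ y = (1, b r)

/-- The amalgamated sum (pushout of commutative monoids) of `P ← R → Q`. -/
abbrev AmalgamatedSum {R P Q : Type*} [CommMonoid R] [CommMonoid P] [CommMonoid Q]
    (a : R →* P) (b : R →* Q) : Type _ :=
  (amalgamCon a b).Quotient

/-- The homomorphism out of the amalgamated sum induced by two homomorphisms that agree on `R`. -/
def AmalgamatedSum.desc {R P Q T : Type*} [CommMonoid R] [CommMonoid P] [CommMonoid Q]
    [CommMonoid T] (a : R →* P) (b : R →* Q) (f : P →* T) (g : Q →* T)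
    (h : ∀ r, f (a r) = g (b r)) : AmalgamatedSum a b →* T :=
  (amalgamCon a b).lift (f.coprod g) (Con.conGen_le.2 (by
    rintro _ _ ⟨r, rfl, rfl⟩
    simp [Con.ker_rel, h r]))

/-- A monoid is saturated if it is integral (cancellative) and every element `x = a / b` of its
group completion with `x ^ n` in the monoid for some `n ≥ 1` lies itself in the monoid. -/
structure IsSaturatedMonoid (P : Type*) [CommMonoid P] : Prop where
  isCancelMul : IsCancelMul P
  dvd_of_pow_dvd_pow : ∀ (a b : P) (n : ℕ), 1 ≤ n → b ^ n ∣ a ^ n → b ∣ a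

/-- An fs monoid: finitely generated and saturated (in particular integral). -/
structure IsFsMonoid (P : Type*) [CommMonoid P] : Prop where
  fg : Monoid.FG P
  isSaturated : IsSaturatedMonoid P

/-- A free monoid, i.e. one isomorphic to `ℕ^r` for some `r ≥ 0`. -/
def IsFreeMonoidOfFiniteRank (P : Type*) [CommMonoid P] : Prop :=
  ∃ r : ℕ, Nonempty (P ≃* Multiplicative (Fin r → ℕ))

/-- An integral homomorphism of (integral) monoids. -/
def IsIntegralHom {P Q : Type*} [CommMonoid P] [CommMonoid Q] (h : P →* Q) : Prop :=
  ∀ (a₁ a₂ : P) (b₁ b₂ : Q), h a₁ * b₁ = h a₂ * b₂ →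
    ∃ (a₃ a₄ : P) (b : Q), b₁ = h a₃ * b ∧ b₂ = h a₄ * b ∧ a₁ * a₃ = a₂ * a₄

/-- A saturated homomorphism of saturated monoids: it is integral, and its pushout along any
homomorphism to a saturated monoid is again a saturated monoid. -/
def IsSaturatedHom {P Q : Type u} [CommMonoid P] [CommMonoid Q] (h : P →* Q) : Prop :=
  IsIntegralHom h ∧
    ∀ (P' : Type u) [CommMonoid P'] (g : P →* P'), IsSaturatedMonoid P' →
      IsSaturatedMonoid (AmalgamatedSum g h)

/-- The quotient monoid of `Q` by the image of `h : P → Q` is a group. -/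
def IsVerticalHom {P Q : Type*} [CommMonoid P] [CommMonoid Q] (h : P →* Q) : Prop :=
  ∀ z : (conGen fun x y : Q => y = 1 ∧ ∃ p : P, x = h p).Quotient, IsUnit z

/-- `h : P → Q` is isomorphic (as an arrow) to the product over `i : Fin r` of the homomorphisms
`d i : ℕ → ℕ^{s i}`. -/
def IsIsoToProduct {P Q : Type*} [CommMonoid P] [CommMonoid Q] (h : P →* Q) {r : ℕ}
    (s : Fin r → ℕ) (d : ∀ i, ℕ →+ (Fin (s i) → ℕ)) : Prop :=
  ∃ (e : P ≃* Multiplicative (Fin r → ℕ)) (e' : Q ≃* Multiplicative (∀ i, Fin (s i) → ℕ)),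
    ∀ (p : P) (i : Fin r), (e' (h p)).toAdd i = d i ((e p).toAdd i)

/-- The diagonal map `ℕ → ℕ^s`, `1 ↦ (1, …, 1)`. -/
def natDiagonal (s : ℕ) : ℕ →+ (Fin s → ℕ) where
  toFun n := fun _ => n
  map_zero' := rfl
  map_add' _ _ := rfl

/-- `h` is isomorphic to a product of diagonal maps `ℕ → ℕ^{s i}`. -/
def IsProductOfDiagonals {P Q : Type*} [CommMonoid P] [CommMonoid Q] (h : P →* Q) : Prop :=
  ∃ (r : ℕ) (s : Fin r → ℕ), IsIsoToProduct h s fun i => natDiagonal (s i)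

/-- The homomorphism `P / Pˣ → Q / Qˣ` induced by `h : P → Q`. -/
def associatesMap {P Q : Type*} [CommMonoid P] [CommMonoid Q] (h : P →* Q) :
    Associates P →* Associates Q where
  toFun := Quotient.map h fun _ _ => Associated.map h
  map_one' := congrArg Associates.mk (map_one h)
  map_mul' := by
    rintro ⟨a⟩ ⟨b⟩
    exact congrArg Associates.mk (map_mul h a b)

/-! ## Sheaves through their stalks

A sheaf with stalks `T x` is given as the subsheaf of the sheaf of all functions
`x ↦ s x ∈ T x` cut out by a `TopCat.LocalPredicate`, for which Mathlib's comparison map from the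
stalk at `x` of this subsheaf (`TopCat.subsheafToTypes`) to `T x` is bijective.  Every sheaf is of
this form: identify a section with the function that assigns to each point its germ there. -/

/-- The given fibres `T x` are the stalks of the sheaf defined by `F`. -/
def IsStalkSheaf {X : TopCat.{u}} {T : X → Type u} (F : TopCat.LocalPredicate T) : Prop :=
  ∀ x : X, Function.Bijective (TopCat.stalkToFiber F x)

theorem IsStalkSheaf.exists_section {X : TopCat.{u}} {T : X → Type u}
    {F : TopCat.LocalPredicate T} (hF : IsStalkSheaf F) (x : X) (a : T x) :
    ∃ (U : Opens X) (hx : x ∈ U) (s : ∀ y : U, T y), F.pred s ∧ s ⟨x, hx⟩ = a := by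
  obtain ⟨b, rfl⟩ := (hF x).2 a
  obtain ⟨U, hx, s, rfl⟩ := TopCat.Presheaf.exists_germ_eq (TopCat.subsheafToTypes F).presheaf (x := x) b
  exact ⟨U, hx, s.1, s.2, (TopCat.stalkToFiber_germ F U x hx s).symm⟩

theorem IsStalkSheaf.eq_near {X : TopCat.{u}} {T : X → Type u}
    {F : TopCat.LocalPredicate T} (hF : IsStalkSheaf F) (x : X) (U V : Opens X) (hU : x ∈ U)
    (hV : x ∈ V) (s : ∀ y : U, T y) (hs : F.pred s) (t : ∀ y : V, T y) (ht : F.pred t)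
    (h : s ⟨x, hU⟩ = t ⟨x, hV⟩) :
    ∃ W : Opens X, x ∈ W ∧ ∃ (iU : W ≤ U) (iV : W ≤ V),
      ∀ y (hy : y ∈ W), s ⟨y, iU hy⟩ = t ⟨y, iV hy⟩ := by
  have h1 := TopCat.stalkToFiber_germ F U x hU ⟨s, hs⟩
  have h2 := TopCat.stalkToFiber_germ F V x hV ⟨t, ht⟩
  obtain ⟨W, hW, iU, iV, e⟩ := TopCat.Presheaf.germ_eq _ x hU hV _ _
    ((hF x).1 (h1.trans (h.trans h2.symm)))
  refine ⟨W, hW, iU.le, iV.le, fun y hy => ?_⟩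
  exact congrFun (congrArg Subtype.val e) ⟨y, hy⟩

theorem isStalkSheaf_of_germs {X : TopCat.{u}} {T : X → Type u} (F : TopCat.LocalPredicate T)
    (h1 : ∀ (x : X) (a : T x), ∃ (U : Opens X) (hx : x ∈ U) (s : ∀ y : U, T y),
      F.pred s ∧ s ⟨x, hx⟩ = a)
    (h2 : ∀ (x : X) (U V : Opens X) (hU : x ∈ U) (hV : x ∈ V) (s : ∀ y : U, T y), F.pred s →
      ∀ t : ∀ y : V, T y, F.pred t → s ⟨x, hU⟩ = t ⟨x, hV⟩ →
      ∃ W : Opens X, x ∈ W ∧ ∃ (iU : W ≤ U) (iV : W ≤ V),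
        ∀ y (hy : y ∈ W), s ⟨y, iU hy⟩ = t ⟨y, iV hy⟩) : IsStalkSheaf F := by
  intro x
  constructor
  · apply TopCat.stalkToFiber_injective
    intro U V s hs t ht e
    obtain ⟨W, hW, iU, iV, e'⟩ := h2 x U.1 V.1 U.2 V.2 s hs t ht e
    exact ⟨⟨W, hW⟩, homOfLE iU, homOfLE iV, fun w => e' w.1 w.2⟩
  · apply TopCat.stalkToFiber_surjective
    intro a
    obtain ⟨U, hx, s, hs, e⟩ := h1 x a
    exact ⟨⟨U, hx⟩, s, hs, e⟩

/-- The inverse image sheaf `g⁻¹F`, with stalk `T (g y)` at `y`: its sections are the functions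
that are locally of the form `y ↦ t (g y)` for a section `t` of `F`. -/
def inverseImage {X Y : TopCat.{u}} {T : X → Type u} (g : C(Y, X)) (F : TopCat.LocalPredicate T) :
    TopCat.LocalPredicate (fun y : Y => T (g y)) where
  pred {U} s := ∀ x : U, ∃ (W : Opens X) (t : ∀ z : W, T z), F.pred t ∧
    ∃ (U' : Opens Y) (_ : x.1 ∈ U') (hU : U' ≤ U) (hW : ∀ y ∈ U', g y ∈ W),
      ∀ y (hy : y ∈ U'), s ⟨y, hU hy⟩ = t ⟨g y, hW y hy⟩
  res {U V} i s hs x := by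
    obtain ⟨W, t, ht, U', hx, hU, hW, e⟩ := hs (i x)
    exact ⟨W, t, ht, U' ⊓ U, ⟨hx, x.2⟩, inf_le_right, fun y hy => hW y hy.1,
      fun y hy => e y hy.1⟩
  locality {U} s hs x := by
    obtain ⟨V, hx, i, h⟩ := hs x
    obtain ⟨W, t, ht, U', hx', hU, hW, e⟩ := h ⟨x.1, hx⟩
    exact ⟨W, t, ht, U', hx', hU.trans i.le, hW, e⟩

theorem isStalkSheaf_inverseImage {X Y : TopCat.{u}} {T : X → Type u} (g : C(Y, X))
    {F : TopCat.LocalPredicate T} (hF : IsStalkSheaf F) : IsStalkSheaf (inverseImage g F) := by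
  apply isStalkSheaf_of_germs
  · intro x a
    obtain ⟨U, hx, s, hs, e⟩ := hF.exists_section (g x) a
    exact ⟨U.comap g, hx, fun y => s ⟨g y, y.2⟩, fun y => ⟨U, s, hs, U.comap g, y.2, le_rfl,
      fun _ h => h, fun _ _ => rfl⟩, e⟩
  · intro x U V hU hV s hs t ht e
    obtain ⟨W₁, s', hs', U₁, hx₁, hU₁, hW₁, e₁⟩ := hs ⟨x, hU⟩
    obtain ⟨W₂, t', ht', U₂, hx₂, hU₂, hW₂, e₂⟩ := ht ⟨x, hV⟩
    obtain ⟨W, hW, i₁, i₂, e'⟩ := hF.eq_near (g x) W₁ W₂ (hW₁ x hx₁) (hW₂ x hx₂) s' hs' t' ht'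
      ((e₁ x hx₁).symm.trans (e.trans (e₂ x hx₂)))
    refine ⟨U₁ ⊓ U₂ ⊓ W.comap g, ⟨⟨hx₁, hx₂⟩, hW⟩, fun y hy => hU₁ hy.1.1,
      fun y hy => hU₂ hy.1.2, fun y hy => ?_⟩
    exact (e₁ y hy.1.1).trans ((e' (g y) hy.2).trans (e₂ y hy.1.2).symm)

/-! ## Log ringed spaces over `ℂ` -/

/-- A locally ringed space over `ℂ` with a log structure: a topological space `X`, a sheaf `𝒪` of
`ℂ`-algebras with local stalks, a sheaf `M` of commutative monoids and a homomorphism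
`α : M → 𝒪` (multiplicative) inducing an isomorphism `α⁻¹(𝒪ˣ) ≅ 𝒪ˣ`. -/
structure LogSpace : Type (u + 1) where
  carrier : TopCat.{u}
  /-- the stalks of the structure sheaf -/
  O : carrier → Type u
  [commRingO : ∀ x, CommRing (O x)]
  [algebraO : ∀ x, Algebra ℂ (O x)]
  [isLocalRingO : ∀ x, IsLocalRing (O x)]
  /-- the structure sheaf -/
  sheafO : TopCat.LocalPredicate O
  isStalkSheafO : IsStalkSheaf sheafO
  const_mem : ∀ (U : Opens carrier) (c : ℂ), sheafO.pred (fun x : U => algebraMap ℂ (O x) c)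
  add_mem : ∀ (U : Opens carrier) (s t : ∀ x : U, O x), sheafO.pred s → sheafO.pred t →
    sheafO.pred (fun x => s x + t x)
  mul_mem : ∀ (U : Opens carrier) (s t : ∀ x : U, O x), sheafO.pred s → sheafO.pred t →
    sheafO.pred (fun x => s x * t x)
  /-- the stalks of the log structure -/
  M : carrier → Type u
  [commMonoidM : ∀ x, CommMonoid (M x)]
  /-- the sheaf of monoids underlying the log structure -/
  sheafM : TopCat.LocalPredicate M
  isStalkSheafM : IsStalkSheaf sheafM
  one_memM : ∀ U : Opens carrier, sheafM.pred (fun x : U => (1 : M x))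
  mul_memM : ∀ (U : Opens carrier) (s t : ∀ x : U, M x), sheafM.pred s → sheafM.pred t →
    sheafM.pred (fun x => s x * t x)
  /-- the structure homomorphism of the log structure -/
  α : ∀ x, M x →* O x
  α_mem : ∀ (U : Opens carrier) (s : ∀ x : U, M x), sheafM.pred s →
    sheafO.pred (fun x => α x (s x))
  α_units : ∀ (x : carrier) (a : O x), IsUnit a → ∃! m : M x, α x m = a

attribute [instance] LogSpace.commRingO LogSpace.algebraO LogSpace.isLocalRingO
  LogSpace.commMonoidM

namespace LogSpace

/-- A morphism of log ringed spaces over `ℂ`: a continuous map `f` with homomorphisms of sheaves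
`f⁻¹𝒪_Y → 𝒪_X` (of `ℂ`-algebras, local on stalks) and `f⁻¹M_Y → M_X` (of monoids), given on
stalks, compatible with the structure homomorphisms `α`. -/
@[ext]
structure Hom (X Y : LogSpace.{u}) : Type u where
  base : C(X.carrier, Y.carrier)
  mapO : ∀ x, Y.O (base x) →ₐ[ℂ] X.O x
  isLocalHom_mapO : ∀ x, IsLocalHom (mapO x)
  mapO_mem : ∀ (V : Opens Y.carrier) (s : ∀ y : V, Y.O y), Y.sheafO.pred s →
    X.sheafO.pred (fun x : V.comap base => mapO x (s ⟨base x, x.2⟩))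
  mapM : ∀ x, Y.M (base x) →* X.M x
  mapM_mem : ∀ (V : Opens Y.carrier) (s : ∀ y : V, Y.M y), Y.sheafM.pred s →
    X.sheafM.pred (fun x : V.comap base => mapM x (s ⟨base x, x.2⟩))
  α_mapM : ∀ x (m : Y.M (base x)), X.α x (mapM x m) = mapO x (Y.α (base x) m)

/-- The identity morphism. -/
def Hom.id (X : LogSpace.{u}) : Hom X X where
  base := ContinuousMap.id _
  mapO x := AlgHom.id ℂ (X.O x)
  isLocalHom_mapO _ := ⟨fun _ h => h⟩
  mapO_mem _ _ hs := hs
  mapM x := MonoidHom.id (X.M x)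
  mapM_mem _ _ hs := hs
  α_mapM _ _ := rfl

/-- Composition of morphisms. -/
def Hom.comp {X Y Z : LogSpace.{u}} (f : Hom X Y) (g : Hom Y Z) : Hom X Z where
  base := g.base.comp f.base
  mapO x := (f.mapO x).comp (g.mapO (f.base x))
  isLocalHom_mapO x := ⟨fun a h =>
    (g.isLocalHom_mapO (f.base x)).map_nonunit a ((f.isLocalHom_mapO x).map_nonunit _ h)⟩
  mapO_mem V s hs := f.mapO_mem (V.comap g.base) _ (g.mapO_mem V s hs)
  mapM x := (f.mapM x).comp (g.mapM (f.base x))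
  mapM_mem V s hs := f.mapM_mem (V.comap g.base) _ (g.mapM_mem V s hs)
  α_mapM x m := (f.α_mapM x _).trans (congrArg (f.mapO x) (g.α_mapM (f.base x) m))

instance : Category LogSpace.{u} where
  Hom := Hom
  id := Hom.id
  comp := Hom.comp

/-- The open subspace `X|_V`. -/
def restrict (X : LogSpace.{u}) (V : Opens X.carrier) : LogSpace.{u} where
  carrier := TopCat.of V
  O x := X.O x.1
  sheafO := inverseImage (Y := TopCat.of V) ⟨Subtype.val, continuous_subtype_val⟩ X.sheafO
  isStalkSheafO := isStalkSheaf_inverseImage _ X.isStalkSheafO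
  const_mem U c x := ⟨⊤, _, X.const_mem ⊤ c, U, x.2, le_rfl, fun _ _ => trivial, fun _ _ => rfl⟩
  add_mem U s t hs ht x := by
    obtain ⟨W, a, ha, U', hx, hU, hW, e⟩ := hs x
    obtain ⟨W₂, b, hb, U₂, hx₂, hU₂, hW₂, e₂⟩ := ht x
    refine ⟨W ⊓ W₂, fun z => a ⟨z, z.2.1⟩ + b ⟨z, z.2.2⟩, X.add_mem _ _ _
      (X.sheafO.res (homOfLE inf_le_left) a ha) (X.sheafO.res (homOfLE inf_le_right) b hb),
      U' ⊓ U₂, ⟨hx, hx₂⟩, inf_le_left.trans hU, fun y hy => ⟨hW y hy.1, hW₂ y hy.2⟩,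
      fun y hy => congrArg₂ (· + ·) (e y hy.1) (e₂ y hy.2)⟩
  mul_mem U s t hs ht x := by
    obtain ⟨W, a, ha, U', hx, hU, hW, e⟩ := hs x
    obtain ⟨W₂, b, hb, U₂, hx₂, hU₂, hW₂, e₂⟩ := ht x
    refine ⟨W ⊓ W₂, fun z => a ⟨z, z.2.1⟩ * b ⟨z, z.2.2⟩, X.mul_mem _ _ _
      (X.sheafO.res (homOfLE inf_le_left) a ha) (X.sheafO.res (homOfLE inf_le_right) b hb),
      U' ⊓ U₂, ⟨hx, hx₂⟩, inf_le_left.trans hU, fun y hy => ⟨hW y hy.1, hW₂ y hy.2⟩,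
      fun y hy => congrArg₂ (· * ·) (e y hy.1) (e₂ y hy.2)⟩
  M x := X.M x.1
  sheafM := inverseImage (Y := TopCat.of V) ⟨Subtype.val, continuous_subtype_val⟩ X.sheafM
  isStalkSheafM := isStalkSheaf_inverseImage _ X.isStalkSheafM
  one_memM U x := ⟨⊤, _, X.one_memM ⊤, U, x.2, le_rfl, fun _ _ => trivial, fun _ _ => rfl⟩
  mul_memM U s t hs ht x := by
    obtain ⟨W, a, ha, U', hx, hU, hW, e⟩ := hs x
    obtain ⟨W₂, b, hb, U₂, hx₂, hU₂, hW₂, e₂⟩ := ht x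
    refine ⟨W ⊓ W₂, fun z => a ⟨z, z.2.1⟩ * b ⟨z, z.2.2⟩, X.mul_memM _ _ _
      (X.sheafM.res (homOfLE inf_le_left) a ha) (X.sheafM.res (homOfLE inf_le_right) b hb),
      U' ⊓ U₂, ⟨hx, hx₂⟩, inf_le_left.trans hU, fun y hy => ⟨hW y hy.1, hW₂ y hy.2⟩,
      fun y hy => congrArg₂ (· * ·) (e y hy.1) (e₂ y hy.2)⟩
  α x := X.α x.1
  α_mem U s hs x := by
    obtain ⟨W, a, ha, U', hx, hU, hW, e⟩ := hs x
    exact ⟨W, _, X.α_mem W a ha, U', hx, hU, hW, fun y hy => congrArg _ (e y hy)⟩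
  α_units x := X.α_units x.1

/-- The inclusion `X|_V → X` of an open subspace. -/
def ι (X : LogSpace.{u}) (V : Opens X.carrier) : X.restrict V ⟶ X where
  base := ⟨Subtype.val, continuous_subtype_val⟩
  mapO x := AlgHom.id ℂ (X.O x.1)
  isLocalHom_mapO _ := ⟨fun _ h => h⟩
  mapO_mem W s hs x := ⟨W, s, hs, _, x.2, le_rfl, fun _ hy => hy, fun _ _ => rfl⟩
  mapM x := MonoidHom.id (X.M x.1)
  mapM_mem W s hs x := ⟨W, s, hs, _, x.2, le_rfl, fun _ hy => hy, fun _ _ => rfl⟩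
  α_mapM _ _ := rfl

/-- The restriction `X|_{f⁻¹V} → Y|_V` of a morphism `f : X → Y`. -/
def restrictHom {X Y : LogSpace.{u}} (f : X ⟶ Y) (V : Opens Y.carrier) :
    X.restrict (V.comap (Hom.base f)) ⟶ Y.restrict V where
  base := ⟨fun x => ⟨Hom.base f x.1, x.2⟩, by fun_prop⟩
  mapO x := Hom.mapO f x.1
  isLocalHom_mapO x := Hom.isLocalHom_mapO f x.1
  mapO_mem W s hs x := by
    obtain ⟨W', t, ht, U', hx, hU, hW, e⟩ := hs ⟨_, x.2⟩
    exact ⟨W'.comap (Hom.base f), _, Hom.mapO_mem f W' t ht, U'.comap ⟨_, by fun_prop⟩, hx,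
      fun y hy => hU hy, fun y hy => hW _ hy, fun y hy => congrArg _ (e _ hy)⟩
  mapM x := Hom.mapM f x.1
  mapM_mem W s hs x := by
    obtain ⟨W', t, ht, U', hx, hU, hW, e⟩ := hs ⟨_, x.2⟩
    exact ⟨W'.comap (Hom.base f), _, Hom.mapM_mem f W' t ht, U'.comap ⟨_, by fun_prop⟩, hx,
      fun y hy => hU hy, fun y hy => hW _ hy, fun y hy => congrArg _ (e _ hy)⟩
  α_mapM x m := Hom.α_mapM f x.1 m

theorem restrictHom_comp_ι {X Y : LogSpace.{u}} (f : X ⟶ Y) (V : Opens Y.carrier) :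
    restrictHom f V ≫ Y.ι V = X.ι _ ≫ f := rfl

end LogSpace

/-! ## fs log analytic spaces -/

/-- The ring of germs at `p` of holomorphic functions on `ℂ^n`. -/
noncomputable def HoloGerm {n : ℕ} (p : Fin n → ℂ) : Subring (Filter.Germ (𝓝 p) ℂ) where
  carrier := {φ | ∃ g : (Fin n → ℂ) → ℂ, AnalyticAt ℂ g p ∧ (g : Filter.Germ (𝓝 p) ℂ) = φ}
  mul_mem' := by
    rintro _ _ ⟨f, hf, rfl⟩ ⟨g, hg, rfl⟩
    exact ⟨f * g, hf.mul hg, rfl⟩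
  one_mem' := ⟨1, analyticAt_const, rfl⟩
  add_mem' := by
    rintro _ _ ⟨f, hf, rfl⟩ ⟨g, hg, rfl⟩
    exact ⟨f + g, hf.add hg, rfl⟩
  zero_mem' := ⟨0, analyticAt_const, rfl⟩
  neg_mem' := by
    rintro _ ⟨f, hf, rfl⟩
    exact ⟨-f, hf.neg, rfl⟩

/-- The germ at `p` of a function holomorphic near `p`. -/
noncomputable def HoloGerm.mk {n : ℕ} {p : Fin n → ℂ} (g : (Fin n → ℂ) → ℂ) (hg : AnalyticAt ℂ g p) :
    HoloGerm p :=
  ⟨(g : Filter.Germ (𝓝 p) ℂ), g, hg, rfl⟩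

namespace LogSpace

/-- A local model of the ringed space `(X, 𝒪)` on the open set `U`: an isomorphism of `U` with the
closed analytic subspace `(V(f), 𝒪_D / (f))` of an open set `D ⊆ ℂ^n`, where
`f = (f_1, …, f_k)` are holomorphic functions on `D`.  It consists of a homeomorphism `i` from `U`
onto the zero set of `f` together with a homomorphism of sheaves of `ℂ`-algebras
`φ : i⁻¹𝒪_D → 𝒪_U` that is surjective with kernel generated by `f`. -/
structure LocalModel (X : LogSpace.{u}) (U : Opens X.carrier) where
  n : ℕ
  D : Set (Fin n → ℂ)
  isOpen_D : IsOpen D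
  k : ℕ
  f : Fin k → (Fin n → ℂ) → ℂ
  analytic_f : ∀ j, AnalyticOnNhd ℂ (f j) D
  i : U → (Fin n → ℂ)
  isEmbedding_i : IsEmbedding i
  range_i : Set.range i = {z | z ∈ D ∧ ∀ j, f j z = 0}
  i_mem : ∀ u, i u ∈ D
  φ : ∀ u : U, HoloGerm (i u) →+* X.O u
  φ_const : ∀ (u : U) (c : ℂ),
    φ u (HoloGerm.mk (fun _ => c) analyticAt_const) = algebraMap ℂ (X.O u) c
  φ_mem : ∀ (U' : Opens X.carrier) (hU' : U' ≤ U) (g : (Fin n → ℂ) → ℂ)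
    (hg : ∀ u : U', AnalyticAt ℂ g (i ⟨u, hU' u.2⟩)),
    X.sheafO.pred (fun u : U' => φ ⟨u, hU' u.2⟩ (HoloGerm.mk g (hg u)))
  φ_surjective : ∀ u, Function.Surjective (φ u)
  ker_φ : ∀ u, RingHom.ker (φ u) =
    Ideal.span (Set.range fun j => HoloGerm.mk (f j) (analytic_f j (i u) (i_mem u)))

/-- The underlying ringed space is a complex analytic space. -/
def IsAnalytic (X : LogSpace.{u}) : Prop :=
  ∀ x : X.carrier, ∃ U : Opens X.carrier, x ∈ U ∧ Nonempty (X.LocalModel U)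

/-- The submonoid of those elements of `P` that `b : P → M` sends to units. -/
abbrev unitPreimage {P M : Type*} [CommMonoid P] [CommMonoid M] (b : P →* M) : Submonoid P :=
  (IsUnit.submonoid M).comap b

/-- `b : P → M` exhibits `M` as the associated log structure (at one stalk): the map
`P ⊕_{b⁻¹(Mˣ)} Mˣ → M` is an isomorphism.  (`Mˣ` is identified with `𝒪ˣ` through `α`.) -/
def IsChartAt {P M : Type*} [CommMonoid P] [CommMonoid M] (b : P →* M) : Prop :=
  Function.Bijective (AmalgamatedSum.desc (unitPreimage b).subtype
    (IsUnit.liftRight (b.comp (unitPreimage b).subtype) fun p => p.2)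
    b (Units.coeHom M) fun _ => rfl)

/-- The log structure is fs: locally it is associated with a homomorphism from (the constant sheaf
given by) an fs monoid `P`. -/
def IsFsLogStructure (X : LogSpace.{u}) : Prop :=
  ∀ x : X.carrier, ∃ (U : Opens X.carrier) (_ : x ∈ U) (P : Type u) (_ : CommMonoid P)
    (b : ∀ y : U, P →* X.M y), IsFsMonoid P ∧ (∀ p, X.sheafM.pred fun y : U => b y p) ∧
      ∀ y : U, IsChartAt (b y)

/-- `X` is an fs log analytic space. -/
structure IsFsLogAnalytic (X : LogSpace.{u}) : Prop where
  isAnalytic : X.IsAnalytic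
  isFs : X.IsFsLogStructure

/-- The stalk at `x` of `f⁻¹(M_Y / M_Yˣ) → M_X / M_Xˣ`. -/
def mapMbar {X Y : LogSpace.{u}} (f : X ⟶ Y) (x : X.carrier) :
    Associates (Y.M (Hom.base f x)) →* Associates (X.M x) :=
  associatesMap (Hom.mapM f x)

/-- `f` is strict: the log structure of `X` is the pullback of that of `Y`, i.e. on stalks
`M_{Y,f(x)} ⊕_{M_{Y,f(x)}ˣ} M_{X,x}ˣ → M_{X,x}` is an isomorphism. -/
def IsStrict {X Y : LogSpace.{u}} (f : X ⟶ Y) : Prop :=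
  ∀ x, Function.Bijective (AmalgamatedSum.desc (Units.coeHom (Y.M (Hom.base f x)))
    (Units.map (Hom.mapM f x)) (Hom.mapM f x) (Units.coeHom (X.M x)) fun _ => rfl)

/-- `j : T₀ → T` is a strict closed immersion whose ideal has square zero. -/
structure IsLogThickening {T₀ T : LogSpace.{u}} (j : T₀ ⟶ T) : Prop where
  isClosedEmbedding : IsClosedEmbedding (Hom.base j)
  surjective : ∀ x, Function.Surjective (Hom.mapO j x)
  sq_zero : ∀ x, RingHom.ker (Hom.mapO j x) ^ 2 = ⊥
  /-- off the image the ideal is the whole (local, hence nonzero) ring, so the image is `T` -/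
  range_eq : Set.range (Hom.base j) = Set.univ
  isStrict : IsStrict j

end LogSpace

/-- The category of fs log analytic spaces, a full subcategory of log ringed spaces over `ℂ`. -/
structure FsLogAnalyticSpace : Type (u + 1) where
  toLogSpace : LogSpace.{u}
  isFsLogAnalytic : toLogSpace.IsFsLogAnalytic

namespace FsLogAnalyticSpace

open LogSpace

instance : Category FsLogAnalyticSpace.{u} where
  Hom X Y := LogSpace.Hom X.toLogSpace Y.toLogSpace
  id X := LogSpace.Hom.id X.toLogSpace
  comp := LogSpace.Hom.comp

/-- The morphism of log ringed spaces underlying a morphism of fs log analytic spaces. -/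
abbrev log {X Y : FsLogAnalyticSpace.{u}} (f : X ⟶ Y) : X.toLogSpace ⟶ Y.toLogSpace := f

/-- `f` is log smooth: for every strict closed immersion `j : T₀ → T` of fs log analytic spaces
with square-zero ideal and every commutative square `g ≫ f = j ≫ h`, locally on `T` there is a
morphism `T → X` making both triangles commute. -/
def IsLogSmooth {X S : FsLogAnalyticSpace.{u}} (f : X ⟶ S) : Prop :=
  ∀ (T₀ T : FsLogAnalyticSpace.{u}) (j : T₀ ⟶ T) (g : T₀ ⟶ X) (h : T ⟶ S),
    IsLogThickening (log j) → g ≫ f = j ≫ h →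
    ∀ t : T.toLogSpace.carrier, ∃ V : Opens T.toLogSpace.carrier, t ∈ V ∧
      ∃ k : T.toLogSpace.restrict V ⟶ X.toLogSpace,
        k ≫ log f = T.toLogSpace.ι V ≫ log h ∧
        restrictHom (log j) V ≫ k = T₀.toLogSpace.ι _ ≫ log g

/-- The log structure is free: each stalk of `M / Mˣ` is isomorphic to some `ℕ^r`. -/
def IsFree (X : FsLogAnalyticSpace.{u}) : Prop :=
  ∀ x, IsFreeMonoidOfFiniteRank (Associates (X.toLogSpace.M x))

/-- `f` is vertical. -/
def IsVertical {X S : FsLogAnalyticSpace.{u}} (f : X ⟶ S) : Prop :=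
  ∀ x, IsVerticalHom (mapMbar (log f) x)

/-- `f` is saturated. -/
def IsSaturated {X S : FsLogAnalyticSpace.{u}} (f : X ⟶ S) : Prop :=
  ∀ x, IsSaturatedHom (mapMbar (log f) x)

/-- `p` is an fs log point: its underlying analytic space is one point with structure ring `ℂ`. -/
structure IsLogPoint (p : FsLogAnalyticSpace.{u}) : Prop where
  nonempty : Nonempty p.toLogSpace.carrier
  subsingleton : Subsingleton p.toLogSpace.carrier
  bijective : ∀ x, Function.Bijective (algebraMap ℂ (p.toLogSpace.O x))

/-- `g : Z → p` is a semistable log smooth degeneration over the free log point `p`. -/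
structure IsSemistableDegeneration {Z p : FsLogAnalyticSpace.{u}} (g : Z ⟶ p) : Prop where
  isLogPoint : IsLogPoint p
  isFree_base : IsFree p
  isLogSmooth : IsLogSmooth g
  isFree : IsFree Z
  isProductOfDiagonals : ∀ z, IsProductOfDiagonals (mapMbar (log g) z)

/-- `f : X → S` is semistable: `f` is log smooth, the log structure of `S` is free, and every fibre
of `f` is a semistable log smooth degeneration.  The fibre of `f` over a point `s` of `S` is
the fibre product `Z = X ×_S p → p`, where `i : p → S` is the point `s` with the pullback of the log
structure of `S`. -/
structure IsSemistable {X S : FsLogAnalyticSpace.{u}} (f : X ⟶ S) : Prop where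
  isLogSmooth : IsLogSmooth f
  isFree_base : IsFree S
  fibre : ∀ (p Z : FsLogAnalyticSpace.{u}) (i : p ⟶ S) (pr : Z ⟶ X) (g : Z ⟶ p),
    IsLogPoint p → IsStrict (log i) → IsPullback pr g f i → IsSemistableDegeneration g

end FsLogAnalyticSpace

/-! The proof has a geometric and a combinatorial half.

*Geometry.* Every point `s` of `S` underlies a log point `p` whose log structure is induced from
`S`, and the fibre of `f` over `p` is the subspace of `X` with underlying set `f⁻¹(s)`, structure
sheaf `𝒪_X / 𝔪_s 𝒪_X` and induced log structure (`LogSpace.subspace`). It is an analytic space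
because, by Hadamard's lemma, `𝔪_s` is generated by the finitely many coordinates of a local model
(`LogSpace.IsAnalytic.exists_generators_maximalIdeal`), and adding finitely many equations to a
local model gives a local model (`LogSpace.IsStrictImmersion.isAnalytic`). It is the fibre product because
a morphism that maps into the subset and kills the ideal factors uniquely
(`LogSpace.exists_comp_eq`, `LogSpace.eq_of_comp_eq`). As `p → S` and the fibre `→ X` are strict,
the map `M_{S,f(x)} / M_{S,f(x)}ˣ → M_{X,x} / M_{X,x}ˣ` is the same for `f` and for its fibre, and log
smoothness is stable under base change. So the theorem becomes a statement about this map.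

*Combinatorics.* A homomorphism from `ℕ^r` to `ℕ^m` is given by a matrix. Integrality forces
distinct basis vectors to have images with disjoint supports (`IsIntegralHom.natMatrix_eq_zero_or`), which
is the decomposition as a product of homomorphisms `ℕ → ℕ^{s i}`. Verticality makes every
coordinate occur (`IsVerticalHom.exists_natMatrix_ne_zero`), and saturation bounds the entries by
`1` (`IsSaturatedHom.natMatrix_le_one`), so a vertical saturated homomorphism is a product of diagonal
maps. Conversely, a product of diagonal maps is vertical, and it is saturated because the pushout
along an integral homomorphism has an explicit description (`IsIntegralHom.amalgamCon_iff`). -/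

/-! ### Pushouts of monoids along integral homomorphisms -/

/-- Along an integral homomorphism the congruence defining the amalgamated sum is explicit:
equivalent pairs have a common "denominator" `c` on the integral side. Integrality is exactly what
makes the right-hand side transitive. -/
theorem IsIntegralHom.amalgamCon_iff {R P Q : Type*} [CommMonoid R] [CommMonoid P] [CommMonoid Q]
    {a : R →* P} {b : R →* Q} (hb : IsIntegralHom b) {x y : P × Q} :
    amalgamCon a b x y ↔
      ∃ (r r' : R) (c : Q), x.2 = b r * c ∧ y.2 = b r' * c ∧ x.1 * a r = y.1 * a r' := by
  let C : Con (P × Q) :=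
    { r := fun x y => ∃ (r r' : R) (c : Q),
        x.2 = b r * c ∧ y.2 = b r' * c ∧ x.1 * a r = y.1 * a r'
      iseqv := by
        refine ⟨fun x => ⟨1, 1, x.2, by simp, by simp, rfl⟩, ?_, ?_⟩
        · rintro x y ⟨r, r', c, h1, h2, h3⟩
          exact ⟨r', r, c, h2, h1, h3.symm⟩
        · rintro x y z ⟨r, r', c, h1, h2, h3⟩ ⟨t, t', d, h4, h5, h6⟩
          obtain ⟨p, q, k, rfl, rfl, e⟩ := hb r' t c d (h2.symm.trans h4)
          refine ⟨r * p, t' * q, k, by rw [h1, map_mul, mul_assoc], by rw [h5, map_mul, mul_assoc],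
            ?_⟩
          rw [map_mul, ← mul_assoc, h3, mul_assoc, ← map_mul, e, map_mul, ← mul_assoc, h6,
            mul_assoc, ← map_mul]
      mul' := by
        rintro x y z w ⟨r, r', c, h1, h2, h3⟩ ⟨t, t', d, h4, h5, h6⟩
        refine ⟨r * t, r' * t', c * d, ?_, ?_, ?_⟩
        · rw [Prod.snd_mul, h1, h4, map_mul, mul_mul_mul_comm]
        · rw [Prod.snd_mul, h2, h5, map_mul, mul_mul_mul_comm]
        · rw [Prod.fst_mul, Prod.fst_mul, map_mul, map_mul, mul_mul_mul_comm, h3, h6,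
            mul_mul_mul_comm] }
  constructor
  · refine fun h => (Con.conGen_le (c := C)).2 ?_ h
    rintro _ _ ⟨r, rfl, rfl⟩
    exact ⟨1, r, 1, by simp, by simp, by simp⟩
  · obtain ⟨p, q⟩ := x
    obtain ⟨p', q'⟩ := y
    rintro ⟨r, r', c, h1, h2, h3⟩
    dsimp only at h1 h2 h3
    have key : ∀ (p : P) (r : R), amalgamCon a b (p, b r * c) (p * a r, c) := by
      intro p r
      have h : amalgamCon a b (a r, 1) (1, b r) := ConGen.Rel.of _ _ ⟨r, rfl, rfl⟩
      have := (amalgamCon a b).mul ((amalgamCon a b).refl (p, c)) ((amalgamCon a b).symm h)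
      simpa [mul_comm] using this
    subst h1 h2
    have h5 := key p' r'
    rw [← h3] at h5
    exact (amalgamCon a b).trans (key p r) ((amalgamCon a b).symm h5)

theorem Con.quotient_coe_pow {M : Type*} [Monoid M] (c : Con M) (x : M) (n : ℕ) :
    ((x ^ n : M) : c.Quotient) = (x : c.Quotient) ^ n :=
  map_pow c.mk' x n

theorem isIntegralHom_of_group {R G : Type*} [CommMonoid R] [CommGroup G] (b : R →* G) :
    IsIntegralHom b := fun a₁ a₂ b₁ b₂ h =>
  ⟨a₂, a₁, (b a₂)⁻¹ * b₁, by simp, by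
    rw [mul_left_comm, h, inv_mul_cancel_left], mul_comm _ _⟩

theorem amalgamCon_iff_of_group {R P G : Type*} [CommMonoid R] [CommMonoid P] [CommGroup G]
    {a : R →* P} {b : R →* G} {x y : P × G} :
    amalgamCon a b x y ↔ ∃ r r' : R, x.1 * a r = y.1 * a r' ∧ x.2 * b r' = y.2 * b r := by
  rw [(isIntegralHom_of_group b).amalgamCon_iff]
  constructor
  · rintro ⟨r, r', c, h1, h2, h3⟩
    exact ⟨r, r', h3, by rw [h1, h2, mul_right_comm, mul_comm (b r), mul_right_comm]⟩
  · rintro ⟨r, r', h1, h2⟩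
    refine ⟨r, r', (b r)⁻¹ * x.2, by simp, ?_, h1⟩
    rw [mul_left_comm, mul_comm (b r'), h2, mul_comm, mul_inv_cancel_right]

theorem IsIntegralHom.isCancelMul_amalgamatedSum {R P Q : Type*} [CommMonoid R] [CommMonoid P]
    [CommMonoid Q] [IsCancelMul P] [IsCancelMul Q] (a : R →* P) {b : R →* Q}
    (hb : IsIntegralHom b) : IsCancelMul (AmalgamatedSum a b) := by
  have : IsLeftCancelMul (AmalgamatedSum a b) := by
    refine ⟨fun z x y h => ?_⟩
    induction x using Con.induction_on with | _ x
    induction y using Con.induction_on with | _ y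
    induction z using Con.induction_on with | _ z
    dsimp only at h
    rw [← Con.coe_mul, ← Con.coe_mul, Con.eq, hb.amalgamCon_iff] at h
    obtain ⟨r, r', c, h1, h2, h3⟩ := h
    rw [Prod.snd_mul] at h1 h2
    rw [Prod.fst_mul, Prod.fst_mul, mul_assoc, mul_assoc] at h3
    have h3 := mul_left_cancel h3
    have h4 : b r' * x.2 = b r * y.2 := by
      apply mul_left_cancel (a := z.2)
      rw [mul_left_comm, h1, mul_left_comm z.2, h2, mul_left_comm]
    obtain ⟨s, s', d, h5, h6, h7⟩ := hb _ _ _ _ h4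
    refine (Con.eq _).2 (hb.amalgamCon_iff.2 ⟨s, s', d, h5, h6, ?_⟩)
    apply mul_right_cancel (b := a (r * r'))
    calc x.1 * a s * a (r * r') = (x.1 * a r) * a (r' * s) := by
          simp only [map_mul, mul_comm, mul_left_comm]
      _ = (y.1 * a r') * a (r * s') := by rw [h3, h7]
      _ = y.1 * a s' * a (r * r') := by
          simp only [map_mul, mul_comm, mul_left_comm]
  exact CommMagma.IsLeftCancelMul.toIsCancelMul _

/-! ### Products of diagonal maps are vertical and saturated -/

theorem isIntegralHom_of_isIsoToProduct {P Q : Type*} [CommMonoid P] [CommMonoid Q] {h : P →* Q}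
    {r : ℕ} {s : Fin r → ℕ} {d : ∀ i, ℕ →+ (Fin (s i) → ℕ)} (H : IsIsoToProduct h s d) :
    IsIntegralHom h := by
  obtain ⟨e, e', H⟩ := H
  intro a₁ a₂ b₁ b₂ hab
  have hd : ∀ i n j, d i n j = n * d i 1 j := by
    intro i n j
    have := map_nsmul (d i) n 1
    rw [nsmul_one, Nat.cast_id] at this
    rw [this, Pi.smul_apply, smul_eq_mul]
  -- Truncated subtraction: at every index at most one of the two differences is nonzero.
  have key : ∀ (a₁ a₂ : P) (b₁ b₂ : Q), h a₁ * b₁ = h a₂ * b₂ →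
      b₁ = h (e.symm (.ofAdd ((e a₂).toAdd - (e a₁).toAdd))) *
        e'.symm (.ofAdd fun i j => min ((e' b₁).toAdd i j) ((e' b₂).toAdd i j)) := by
    intro a₁ a₂ b₁ b₂ hab
    apply e'.injective
    apply Multiplicative.toAdd.injective
    funext i j
    have h0 := congrFun (congrFun (congrArg (fun x => (e' x).toAdd) hab) i) j
    simp only [map_mul, toAdd_mul, Pi.add_apply, H, MulEquiv.apply_symm_apply, toAdd_ofAdd,
      Pi.sub_apply] at h0 ⊢
    rw [hd] at h0 ⊢
    rw [hd i ((e a₂).toAdd i)] at h0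
    rcases le_total ((e a₁).toAdd i) ((e a₂).toAdd i) with hle | hle
    · obtain ⟨k, hk⟩ := Nat.exists_eq_add_of_le hle
      rw [hk, add_mul] at h0
      rw [hk, Nat.add_sub_cancel_left]
      omega
    · obtain ⟨k, hk⟩ := Nat.exists_eq_add_of_le hle
      rw [hk, add_mul] at h0
      rw [Nat.sub_eq_zero_of_le hle]
      omega
  refine ⟨_, _, _, key a₁ a₂ b₁ b₂ hab,
    by simpa only [min_comm] using key a₂ a₁ b₂ b₁ hab.symm, ?_⟩
  apply e.injective
  apply Multiplicative.toAdd.injective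
  funext i
  simp only [map_mul, toAdd_mul, Pi.add_apply, MulEquiv.apply_symm_apply, toAdd_ofAdd,
    Pi.sub_apply]
  omega

theorem isCancelMul_of_mulEquiv {P Q : Type*} [CommMonoid P] [CommMonoid Q] [IsCancelMul Q]
    (e : P ≃* Q) : IsCancelMul P :=
  e.injective.isCancelMul _ (map_mul e)

theorem IsProductOfDiagonals.isVerticalHom {P Q : Type*} [CommMonoid P] [CommMonoid Q]
    {h : P →* Q} (H : IsProductOfDiagonals h) : IsVerticalHom h := by
  obtain ⟨r, s, e, e', H⟩ := H
  intro z
  induction z using Con.induction_on with | _ q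
  -- `q` divides the image of `(n, …, n)`, where `n` is the sum of all coordinates of `q`.
  let v := (e' q).toAdd
  let n := ∑ i, ∑ j, v i j
  have hle : ∀ i j, v i j ≤ n := fun i j =>
    (Finset.single_le_sum (f := fun j => v i j) (fun _ _ => Nat.zero_le _)
      (Finset.mem_univ j)).trans
      (Finset.single_le_sum (f := fun i => ∑ j, v i j) (fun _ _ => Nat.zero_le _)
        (Finset.mem_univ i))
  have hq : q * e'.symm (.ofAdd fun i j => n - v i j) = h (e.symm (.ofAdd fun _ => n)) := by
    apply e'.injective
    apply Multiplicative.toAdd.injective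
    funext i j
    rw [H]
    simp only [map_mul, toAdd_mul, Pi.add_apply, MulEquiv.apply_symm_apply, toAdd_ofAdd,
      natDiagonal, AddMonoidHom.coe_mk, ZeroHom.coe_mk]
    have := hle i j
    change v i j + _ = _
    omega
  refine IsUnit.of_mul_eq_one
    ((e'.symm (.ofAdd fun i j => n - v i j) : Q) : Con.Quotient _) ?_
  rw [← Con.coe_mul, ← Con.coe_one, hq]
  exact (Con.eq _).2 (ConGen.Rel.of _ _ ⟨rfl, _, rfl⟩)

/-- Suppose `b ^ n` divides `a ^ n` in the pushout, where `a` and `b` have vector parts `q` and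
`q'`. The difference `q - q'` dominates the diagonal image of some `m ∈ ℤ^r` (written `k - l` below) that
is large enough for the remaining divisibility to be one of `n`-th powers in the saturated monoid
`P'`. -/
theorem IsProductOfDiagonals.isSaturatedHom {P Q : Type u} [CommMonoid P] [CommMonoid Q]
    {h : P →* Q} (H : IsProductOfDiagonals h) : IsSaturatedHom h := by
  obtain ⟨r, s, H⟩ := H
  have hint := isIntegralHom_of_isIsoToProduct H
  refine ⟨hint, fun P' _ g hP' => ?_⟩
  obtain ⟨e, e', H⟩ := H
  have := hP'.isCancelMul
  have := isCancelMul_of_mulEquiv e'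
  have hcan := hint.isCancelMul_amalgamatedSum g
  refine ⟨hcan, fun a b n hn hab => ?_⟩
  induction a using Con.induction_on with | _ a
  induction b using Con.induction_on with | _ b
  obtain ⟨c, hc⟩ := hab
  induction c using Con.induction_on with | _ c
  rw [← Con.quotient_coe_pow, ← Con.quotient_coe_pow, ← Con.coe_mul, Con.eq,
    hint.amalgamCon_iff] at hc
  obtain ⟨p, q⟩ := a
  obtain ⟨p', q'⟩ := b
  obtain ⟨t, w⟩ := c
  obtain ⟨x, x', y, h1, h2, h3⟩ := hc
  simp only [Prod.pow_mk, Prod.mk_mul_mk] at h1 h2 h3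
  have H' : ∀ p i j, (e' (h p)).toAdd i j = (e p).toAdd i := fun p i j => by rw [H]; rfl
  have key : ∀ i, ∃ k l : ℕ, (∀ j, (e' q').toAdd i j + k ≤ (e' q).toAdd i j + l) ∧
      (e x).toAdd i + n * l ≤ (e x').toAdd i + n * k := by
    intro i
    have hrel : ∀ j, n * (e' q).toAdd i j + (e x').toAdd i =
        n * (e' q').toAdd i j + (e' w).toAdd i j + (e x).toAdd i := by
      intro j
      have h1 := congrFun (congrFun (congrArg (fun z => (e' z).toAdd) h1) i) j
      have h2 := congrFun (congrFun (congrArg (fun z => (e' z).toAdd) h2) i) j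
      simp only [map_mul, map_pow, toAdd_mul, toAdd_pow, Pi.add_apply, Pi.smul_apply,
        smul_eq_mul, H'] at h1 h2
      omega
    by_cases hs : Nonempty (Fin (s i))
    · -- `k - l` is the minimum over `j` of `q i j - q' i j`.
      obtain ⟨j, hj⟩ := Finite.exists_min
        fun j => ((e' q).toAdd i j : ℤ) - ((e' q').toAdd i j : ℤ)
      refine ⟨(e' q).toAdd i j, (e' q').toAdd i j, fun j' => ?_, ?_⟩
      · have := hj j'
        omega
      · have := hrel j
        omega
    · -- No coordinates: any sufficiently large `k` will do.
      refine ⟨(e x).toAdd i, 0, fun j => (hs ⟨j⟩).elim, ?_⟩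
      have := Nat.le_mul_of_pos_left ((e x).toAdd i) hn
      omega
  choose k l hkl hkl' using key
  let K : P := e.symm (.ofAdd k)
  let L : P := e.symm (.ofAdd l)
  have hdvd : p' * g L ∣ p * g K := by
    refine hP'.dvd_of_pow_dvd_pow _ _ n hn
      ⟨t * g (e.symm (.ofAdd fun i => (e x').toAdd i + n * k i - ((e x).toAdd i + n * l i))), ?_⟩
    have hx : x' * K ^ n = x * L ^ n *
        e.symm (.ofAdd fun i => (e x').toAdd i + n * k i - ((e x).toAdd i + n * l i)) := by
      apply e.injective
      apply Multiplicative.toAdd.injective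
      funext i
      simp only [K, L, map_mul, map_pow, toAdd_mul, toAdd_pow, Pi.add_apply, Pi.smul_apply,
        smul_eq_mul, MulEquiv.apply_symm_apply, toAdd_ofAdd]
      have := hkl' i
      omega
    apply mul_right_cancel (b := g x)
    calc (p * g K) ^ n * g x = (p ^ n * g x) * g (K ^ n) := by
          rw [mul_pow, map_pow]; ac_rfl
      _ = p' ^ n * t * g (x' * K ^ n) := by rw [h3, map_mul]; ac_rfl
      _ = _ := by rw [hx, map_mul, map_mul, map_pow, mul_pow]; ac_rfl
  obtain ⟨t', ht'⟩ := hdvd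
  let U : Q := e'.symm (.ofAdd fun i j =>
    (e' q).toAdd i j + l i - ((e' q').toAdd i j + k i))
  have hU : q * h L = q' * U * h K := by
    apply e'.injective
    apply Multiplicative.toAdd.injective
    funext i j
    simp only [map_mul, toAdd_mul, Pi.add_apply, H', U, K, L, MulEquiv.apply_symm_apply,
      toAdd_ofAdd]
    have := hkl i j
    omega
  refine ⟨((t', U) : P' × Q), ?_⟩
  rw [← Con.coe_mul]
  apply mul_right_cancel (b := (((1 : P'), h L) : (amalgamCon g h).Quotient))
  rw [← Con.coe_mul, ← Con.coe_mul, Con.eq, hint.amalgamCon_iff]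
  refine ⟨K, L, q' * U, ?_, ?_, ?_⟩
  · simp only [Prod.mk_mul_mk]; rw [hU, mul_comm]
  · simp only [Prod.mk_mul_mk]; rw [mul_comm]
  · simp only [Prod.mk_mul_mk, mul_one]; rw [ht', mul_right_comm]

/-! ### Integral homomorphisms between free monoids -/

/-- The `(i, k)` entry of the matrix of a homomorphism `ℕ^r → ℕ^m`. -/
def natMatrix {r m : ℕ} (h : Multiplicative (Fin r → ℕ) →* Multiplicative (Fin m → ℕ))
    (i : Fin r) (k : Fin m) : ℕ :=
  (h (.ofAdd (Pi.single i 1))).toAdd k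

theorem toAdd_apply_eq_sum_natMatrix {r m : ℕ}
    (h : Multiplicative (Fin r → ℕ) →* Multiplicative (Fin m → ℕ))
    (a : Multiplicative (Fin r → ℕ)) (k : Fin m) :
    (h a).toAdd k = ∑ i, a.toAdd i * natMatrix h i k := by
  let φ : (Fin r → ℕ) →+ ℕ := (Pi.evalAddMonoidHom _ k).comp (AddMonoidHom.toMultiplicative.symm h)
  let ψ : (Fin r → ℕ) →+ ℕ :=
    { toFun := fun a => ∑ i, a i * natMatrix h i k
      map_zero' := by simp
      map_add' := fun a b => by simp [add_mul, Finset.sum_add_distrib] }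
  have : φ = ψ := by
    refine AddMonoidHom.functions_ext' ℕ φ ψ fun i => AddMonoidHom.ext_nat ?_
    change natMatrix h i k = ∑ j, (Pi.single i 1 : Fin r → ℕ) j * natMatrix h j k
    rw [Finset.sum_eq_single i]
    · simp
    · intro j _ hj; simp [hj]
    · simp
  exact DFunLike.congr_fun this a.toAdd

/-- Apply integrality to the equation `u + (u ⊔ v - u) = v + (u ⊔ v - v)`, where `u` and `v` are the
images of two distinct basis vectors: a common coordinate of `u` and `v` would contradict it. -/
theorem IsIntegralHom.natMatrix_eq_zero_or {r m : ℕ}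
    {h : Multiplicative (Fin r → ℕ) →* Multiplicative (Fin m → ℕ)} (hh : IsIntegralHom h)
    {i j : Fin r} (hij : i ≠ j) (k : Fin m) : natMatrix h i k = 0 ∨ natMatrix h j k = 0 := by
  let u := (h (.ofAdd (Pi.single i 1))).toAdd
  let v := (h (.ofAdd (Pi.single j 1))).toAdd
  obtain ⟨a, a', b, h1, -, h3⟩ := hh (.ofAdd (Pi.single i 1)) (.ofAdd (Pi.single j 1))
    (.ofAdd (u ⊔ v - u)) (.ofAdd (u ⊔ v - v)) (by
      apply Multiplicative.toAdd.injective
      funext l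
      change u l + (max (u l) (v l) - u l) = v l + (max (u l) (v l) - v l)
      omega)
  have h3 := congrFun (congrArg Multiplicative.toAdd h3) j
  simp only [toAdd_mul, toAdd_ofAdd, Pi.add_apply, Pi.single_eq_same,
    Pi.single_eq_of_ne hij.symm] at h3
  have h1 := congrFun (congrArg Multiplicative.toAdd h1) k
  rw [toAdd_mul, Pi.add_apply, toAdd_apply_eq_sum_natMatrix] at h1
  have hle : a.toAdd j * natMatrix h j k ≤ ∑ i, a.toAdd i * natMatrix h i k :=
    Finset.single_le_sum (f := fun i => a.toAdd i * natMatrix h i k)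
      (fun _ _ => Nat.zero_le _) (Finset.mem_univ j)
  have hle' := Nat.mul_le_mul_right (natMatrix h j k) (show 1 ≤ a.toAdd j by omega)
  change max (natMatrix h i k) (natMatrix h j k) - natMatrix h i k = _ at h1
  omega

/-- If every coordinate of the target receives from at most one basis vector, grouping the
coordinates accordingly exhibits the homomorphism as a product. -/
theorem exists_isIsoToProduct_of_natMatrix {r m : ℕ}
    (h : Multiplicative (Fin r → ℕ) →* Multiplicative (Fin m → ℕ)) (σ : Fin m → Fin r)
    (hσ : ∀ i k, i ≠ σ k → natMatrix h i k = 0) :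
    ∃ (s : Fin r → ℕ) (d : ∀ i, ℕ →+ (Fin (s i) → ℕ)), m = ∑ i, s i ∧ IsIsoToProduct h s d ∧
      ∀ i j, ∃ k, σ k = i ∧ ∀ n, d i n j = n * natMatrix h i k := by
  let s : Fin r → ℕ := fun i => Fintype.card {k // σ k = i}
  let E : ∀ i, {k // σ k = i} ≃ Fin (s i) := fun i => Fintype.equivFin _
  let d : ∀ i, ℕ →+ (Fin (s i) → ℕ) := fun i =>
    { toFun := fun n j => n * natMatrix h i ((E i).symm j).1
      map_zero' := by funext j; simp
      map_add' := fun a b => by funext j; simp [add_mul] }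
  let e' : Multiplicative (Fin m → ℕ) ≃* Multiplicative (∀ i, Fin (s i) → ℕ) :=
    { toFun := fun v => .ofAdd fun i j => v.toAdd ((E i).symm j).1
      invFun := fun w => .ofAdd fun k => w.toAdd (σ k) (E (σ k) ⟨k, rfl⟩)
      left_inv := fun v => by
        apply Multiplicative.toAdd.injective
        funext k
        simp
      right_inv := fun w => by
        apply Multiplicative.toAdd.injective
        funext i j
        have : ∀ (i' : Fin r) (k : {k // σ k = i'}),
            w.toAdd (σ k.1) (E (σ k.1) ⟨k.1, rfl⟩) = w.toAdd i' (E i' k) := by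
          rintro _ ⟨k, rfl⟩
          rfl
        simpa using this i ((E i).symm j)
      map_mul' := fun _ _ => rfl }
  refine ⟨s, d, ?_, ⟨MulEquiv.refl _, e', fun p i => ?_⟩, fun i j =>
    ⟨((E i).symm j).1, ((E i).symm j).2, fun n => rfl⟩⟩
  · rw [← Fintype.card_sigma, Fintype.card_congr (Equiv.sigmaFiberEquiv σ), Fintype.card_fin]
  · funext j
    change (h p).toAdd ((E i).symm j).1 = p.toAdd i * natMatrix h i ((E i).symm j).1
    rw [toAdd_apply_eq_sum_natMatrix, Finset.sum_eq_single i]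
    · intro i' _ hi'
      rw [hσ i' _ fun h => hi' (h.trans ((E i).symm j).2), mul_zero]
    · simp

theorem isIntegralHom_iff_exists_isIsoToProduct {r m : ℕ} (hr : 1 ≤ r)
    (h : Multiplicative (Fin r → ℕ) →* Multiplicative (Fin m → ℕ)) :
    IsIntegralHom h ↔ ∃ (s : Fin r → ℕ) (d : ∀ i, ℕ →+ (Fin (s i) → ℕ)),
      m = ∑ i, s i ∧ IsIsoToProduct h s d := by
  constructor
  · intro hh
    have : ∀ k, ∃ i₀ : Fin r, ∀ i, i ≠ i₀ → natMatrix h i k = 0 := by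
      intro k
      by_cases hk : ∃ i, natMatrix h i k ≠ 0
      · obtain ⟨i₀, hi₀⟩ := hk
        exact ⟨i₀, fun i hi => (hh.natMatrix_eq_zero_or hi k).resolve_right hi₀⟩
      · push Not at hk
        -- A coordinate that receives nothing may be assigned to any factor.
        exact ⟨⟨0, hr⟩, fun i _ => hk i⟩
    choose σ hσ using this
    obtain ⟨s, d, hm, H, -⟩ := exists_isIsoToProduct_of_natMatrix h σ fun i k => hσ k i
    exact ⟨s, d, hm, H⟩
  · rintro ⟨s, d, -, H⟩
    exact isIntegralHom_of_isIsoToProduct H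

/-! ### Vertical saturated homomorphisms between free monoids -/

theorem IsIntegralHom.congr_mulEquiv {P Q P' Q' : Type*} [CommMonoid P] [CommMonoid Q]
    [CommMonoid P'] [CommMonoid Q'] {h : P →* Q} (hh : IsIntegralHom h) (e : P ≃* P')
    (e' : Q ≃* Q') : IsIntegralHom ((e'.toMonoidHom.comp h).comp e.symm.toMonoidHom) := by
  intro a₁ a₂ b₁ b₂ hab
  obtain ⟨a₃, a₄, b, h1, h2, h3⟩ := hh (e.symm a₁) (e.symm a₂) (e'.symm b₁) (e'.symm b₂) (by
    apply e'.injective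
    rw [map_mul, map_mul, e'.apply_symm_apply, e'.apply_symm_apply]
    exact hab)
  refine ⟨e a₃, e a₄, e' b, ?_, ?_, ?_⟩
  · rw [← e'.apply_symm_apply b₁, h1]; simp
  · rw [← e'.apply_symm_apply b₂, h2]; simp
  · apply e.symm.injective; simpa using h3

/-- A coordinate receiving nothing would give a homomorphism to `ℕ` that kills the image of `h` and
hence factors through the quotient group, so it would be trivial. -/
theorem IsVerticalHom.exists_natMatrix_ne_zero {P Q : Type*} [CommMonoid P] [CommMonoid Q]
    {h : P →* Q} (hh : IsVerticalHom h) {r m : ℕ} (e : P ≃* Multiplicative (Fin r → ℕ))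
    (e' : Q ≃* Multiplicative (Fin m → ℕ)) (k : Fin m) :
    ∃ i, natMatrix ((e'.toMonoidHom.comp h).comp e.symm.toMonoidHom) i k ≠ 0 := by
  by_contra! hk
  let ψ : Q →* Multiplicative ℕ :=
    { toFun := fun q => .ofAdd ((e' q).toAdd k)
      map_one' := by simp
      map_mul' := fun x y => by simp }
  have hψ : ∀ p, ψ (h p) = 1 := by
    intro p
    have := toAdd_apply_eq_sum_natMatrix
      ((e'.toMonoidHom.comp h).comp e.symm.toMonoidHom) (e p) k
    simp only [hk, mul_zero, Finset.sum_const_zero] at this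
    apply Multiplicative.toAdd.injective
    simpa [ψ] using this
  let q : Q := e'.symm (.ofAdd (Pi.single k 1))
  have hu := (hh q).map (Con.lift _ ψ (Con.conGen_le.2 (by
    rintro x y ⟨rfl, p, rfl⟩
    rw [Con.ker_rel, hψ, map_one])))
  rw [Con.lift_coe] at hu
  have h1 : ψ q = .ofAdd 1 := by simp [ψ, q]
  rw [h1] at hu
  obtain ⟨b, hb⟩ := hu.exists_right_inv
  have := congrArg Multiplicative.toAdd hb
  rw [toAdd_mul, toAdd_ofAdd, toAdd_one] at this
  omega

/-- An entry `c ≥ 2` is excluded by pushing out along `ℕ^r → ℕ`, `a ↦ c a_i`: in the pushout, the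
generator `x` of `ℕ` and the basis vector `y` at the given coordinate satisfy `y ^ c ∣ x ^ c`, but
`y` does not divide `x`. -/
theorem IsSaturatedHom.natMatrix_le_one {P Q : Type u} [CommMonoid P] [CommMonoid Q]
    {h : P →* Q} (hh : IsSaturatedHom h) {r m : ℕ} (e : P ≃* Multiplicative (Fin r → ℕ))
    (e' : Q ≃* Multiplicative (Fin m → ℕ)) (i : Fin r) (k : Fin m) :
    natMatrix ((e'.toMonoidHom.comp h).comp e.symm.toMonoidHom) i k ≤ 1 := by
  by_contra! hc
  let h' := (e'.toMonoidHom.comp h).comp e.symm.toMonoidHom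
  have hint : IsIntegralHom h' := hh.1.congr_mulEquiv e e'
  let c := natMatrix h' i k
  have hc : 2 ≤ c := hc
  have hcoord : ∀ p, (e' (h p)).toAdd k = c * (e p).toAdd i := by
    intro p
    have := toAdd_apply_eq_sum_natMatrix h' (e p) k
    rw [Finset.sum_eq_single i, mul_comm] at this
    · have h2 : (h' (e p)).toAdd k = (e' (h p)).toAdd k := by simp [h']
      rw [← h2, this]
    · intro j _ hj
      rw [(hint.natMatrix_eq_zero_or hj k).resolve_right (show c ≠ 0 by omega), mul_zero]
    · simp
  let g : P →* ULift.{u} (Multiplicative ℕ) :=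
    { toFun := fun p => ⟨.ofAdd (c * (e p).toAdd i)⟩
      map_one' := by simp; rfl
      map_mul' := fun x y => by simp [mul_add]; rfl }
  have hsat : IsSaturatedMonoid (ULift.{u} (Multiplicative ℕ)) := by
    refine ⟨isCancelMul_of_mulEquiv MulEquiv.ulift, ?_⟩
    rintro ⟨a⟩ ⟨b⟩ n hn ⟨⟨d⟩, hd⟩
    have hd : n * a.toAdd = n * b.toAdd + d.toAdd :=
      congrArg (fun x => (ULift.down x).toAdd) hd
    have hle : b.toAdd ≤ a.toAdd := by
      refine Nat.le_of_mul_le_mul_left (c := n) ?_ hn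
      omega
    refine ⟨⟨.ofAdd (a.toAdd - b.toAdd)⟩, ?_⟩
    apply ULift.down_injective
    apply Multiplicative.toAdd.injective
    change a.toAdd = b.toAdd + (a.toAdd - b.toAdd)
    omega
  have hpush := hh.2 _ g hsat
  let x : AmalgamatedSum g h := (((⟨.ofAdd 1⟩ : ULift.{u} (Multiplicative ℕ)), (1 : Q)) :)
  let ek : Q := e'.symm (.ofAdd (Pi.single k 1))
  let y : AmalgamatedSum g h := (((1 : ULift.{u} (Multiplicative ℕ)), ek) :)
  let p₀ : P := e.symm (.ofAdd (Pi.single i 1))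
  have hyx : y ^ c ∣ x ^ c := by
    have hdvd : ek ^ c ∣ h p₀ := by
      refine ⟨e'.symm (.ofAdd ((e' (h p₀)).toAdd - (e' (ek ^ c)).toAdd)), ?_⟩
      apply e'.injective
      apply Multiplicative.toAdd.injective
      funext l
      rw [map_mul, e'.apply_symm_apply, toAdd_mul, toAdd_ofAdd, Pi.add_apply, Pi.sub_apply]
      have : (e' (ek ^ c)).toAdd l ≤ (e' (h p₀)).toAdd l := by
        rcases eq_or_ne l k with rfl | hl
        · rw [hcoord]; simp [ek, p₀]
        · simp [ek, hl]
      omega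
    obtain ⟨z, hz⟩ := hdvd
    refine ⟨(((1 : ULift.{u} (Multiplicative ℕ)), z) :), ?_⟩
    rw [← Con.quotient_coe_pow, ← Con.quotient_coe_pow, ← Con.coe_mul, Con.eq, hh.1.amalgamCon_iff]
    refine ⟨1, p₀, 1, by simp, by simp [hz], ?_⟩
    apply ULift.down_injective
    apply Multiplicative.toAdd.injective
    simp [g, p₀]
  obtain ⟨z, hz⟩ := hpush.dvd_of_pow_dvd_pow x y c (by omega) hyx
  induction z using Con.induction_on with | _ z
  rw [← Con.coe_mul, Con.eq, hh.1.amalgamCon_iff] at hz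
  obtain ⟨⟨t⟩, w⟩ := z
  obtain ⟨a, a', d, h1, h2, h3⟩ := hz
  have h1 : (e' 1).toAdd k = (e' (h a * d)).toAdd k :=
    congrFun (congrArg (fun x => (e' x).toAdd) h1) k
  have h2 : (e' (ek * w)).toAdd k = (e' (h a' * d)).toAdd k :=
    congrFun (congrArg (fun x => (e' x).toAdd) h2) k
  have h3 : 1 + c * (e a).toAdd i = 0 + t.toAdd + c * (e a').toAdd i :=
    congrArg (fun x => (ULift.down x).toAdd) h3
  simp only [map_mul, map_one, toAdd_mul, toAdd_one, Pi.add_apply, Pi.zero_apply, hcoord, ek,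
    MulEquiv.apply_symm_apply, toAdd_ofAdd, Pi.single_eq_same] at h1 h2
  have h4 : (e a').toAdd i ≠ 0 := by
    intro h0
    rw [h0] at h2
    omega
  have h5 := Nat.mul_le_mul_left c (Nat.one_le_iff_ne_zero.2 h4)
  omega

/-- The matrix has exactly one nonzero entry for every coordinate of the target, by integrality and
verticality, and this entry is `1` by saturation. -/
theorem isProductOfDiagonals_of_isVerticalHom_of_isSaturatedHom {P Q : Type u} [CommMonoid P]
    [CommMonoid Q] {h : P →* Q} (hP : IsFreeMonoidOfFiniteRank P)
    (hQ : IsFreeMonoidOfFiniteRank Q) (hv : IsVerticalHom h) (hs : IsSaturatedHom h) :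
    IsProductOfDiagonals h := by
  obtain ⟨r, ⟨e⟩⟩ := hP
  obtain ⟨m, ⟨e'⟩⟩ := hQ
  choose σ hσ using hv.exists_natMatrix_ne_zero e e'
  obtain ⟨s, d, -, ⟨f, f', H⟩, hd⟩ := exists_isIsoToProduct_of_natMatrix _ σ fun i k hi =>
    ((hs.1.congr_mulEquiv e e').natMatrix_eq_zero_or hi k).resolve_right (hσ k)
  refine ⟨r, s, e.trans f, e'.trans f', fun p i => ?_⟩
  have h1 := H (e p) i
  simp only [MonoidHom.comp_apply, MulEquiv.coe_toMonoidHom, MulEquiv.symm_apply_apply] at h1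
  refine h1.trans ?_
  funext j
  obtain ⟨k, rfl, hk⟩ := hd i j
  have h2 := hs.natMatrix_le_one e e' (σ k) k
  have h3 := hσ k
  rw [hk, show natMatrix _ (σ k) k = 1 by omega, mul_one]
  rfl

/-! ### Germs of holomorphic functions -/

/-- Hadamard's lemma: the increment of an analytic function depends linearly on the increment of
the variable, with coefficients depending analytically on the point. The coefficients are the sum
of the shifted power series. -/
theorem AnalyticAt.exists_eventually_eq_add_apply_sub {𝕜 E F : Type*} [NontriviallyNormedField 𝕜]
    [NormedAddCommGroup E] [NormedSpace 𝕜 E] [NormedAddCommGroup F] [NormedSpace 𝕜 F]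
    [CompleteSpace F] {f : E → F} {x : E} (hf : AnalyticAt 𝕜 f x) :
    ∃ G : E → E →L[𝕜] F, AnalyticAt 𝕜 G x ∧ ∀ᶠ y in 𝓝 x, f y = f x + G y (y - x) := by
  obtain ⟨p, r, hp⟩ := hf
  have hrad : 0 < p.shift.radius := by
    rw [FormalMultilinearSeries.radius_shift]
    exact hp.r_pos.trans_le hp.r_le
  have hG := (p.shift.hasFPowerSeriesOnBall hrad).comp_sub x
  rw [zero_add] at hG
  refine ⟨fun y => p.shift.sum (y - x), hG.analyticAt, ?_⟩
  have hu := hG.unshift (z := f x)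
  have hps : p.shift.unshift (f x) = p := by
    funext n
    cases n with
    | zero =>
      ext v
      rw [hp.coeff_zero v]
      rfl
    | succ n =>
      exact (continuousMultilinearCurryRightEquiv' 𝕜 n E F).symm_apply_apply (p (n + 1))
  rw [hps, FormalMultilinearSeries.radius_shift] at hu
  have heq := hp.unique (hu.mono hp.r_pos hp.r_le)
  exact Filter.eventually_of_mem (Metric.eball_mem_nhds x hp.r_pos) heq

namespace HoloGerm

variable {n : ℕ} {p : Fin n → ℂ}

/-- The value of a germ of holomorphic functions at its base point. -/
noncomputable def eval (p : Fin n → ℂ) : HoloGerm p →+* ℂ :=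
  Filter.Germ.valueRingHom.comp (HoloGerm p).subtype

theorem eval_mk (g : (Fin n → ℂ) → ℂ) (hg : AnalyticAt ℂ g p) : eval p (mk g hg) = g p := rfl

theorem exists_eq_mk (a : HoloGerm p) : ∃ g hg, a = mk g hg := by
  obtain ⟨_, g, hg, rfl⟩ := a
  exact ⟨g, hg, rfl⟩

theorem mk_eq_mk {g h : (Fin n → ℂ) → ℂ} {hg : AnalyticAt ℂ g p} {hh : AnalyticAt ℂ h p}
    (e : g =ᶠ[𝓝 p] h) : mk g hg = mk h hh :=
  Subtype.ext (Filter.Germ.coe_eq.2 e)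

theorem mk_sum {ι : Type*} (s : Finset ι) (g : ι → (Fin n → ℂ) → ℂ)
    (hg : ∀ i, AnalyticAt ℂ (g i) p) (h : AnalyticAt ℂ (fun z => ∑ i ∈ s, g i z) p) :
    mk (fun z => ∑ i ∈ s, g i z) h = ∑ i ∈ s, mk (g i) (hg i) := by
  classical
  induction s using Finset.induction_on with
  | empty => exact mk_eq_mk (hh := analyticAt_const) (.of_forall fun z => by simp)
  | insert i s hi ih =>
    rw [Finset.sum_insert hi, ← ih (s.analyticAt_fun_sum fun i _ => hg i)]
    exact mk_eq_mk (hh := (hg i).add (s.analyticAt_fun_sum fun i _ => hg i))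
      (.of_forall fun z => by simp [Finset.sum_insert hi])

theorem isUnit_of_eval_ne_zero {a : HoloGerm p} (ha : eval p a ≠ 0) : IsUnit a := by
  obtain ⟨g, hg, rfl⟩ := exists_eq_mk a
  rw [eval_mk] at ha
  refine IsUnit.of_mul_eq_one (mk g⁻¹ (hg.inv ha)) ?_
  refine mk_eq_mk (hg := hg.mul (hg.inv ha)) (hh := analyticAt_const) ?_
  filter_upwards [hg.continuousAt.eventually_ne ha] with z hz
  exact mul_inv_cancel₀ hz

theorem analyticAt_coordinate_sub (q : Fin n → ℂ) (j : Fin n) :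
    AnalyticAt ℂ (fun z : Fin n → ℂ => z j - q j) p :=
  ((ContinuousLinearMap.proj (R := ℂ) (φ := fun _ : Fin n => ℂ) j).analyticAt p).sub
    analyticAt_const

/-- The germs vanishing at `p` form the ideal generated by the coordinates centred at `p`. -/
theorem mem_span_coordinates_of_eval_eq_zero {a : HoloGerm p} (ha : eval p a = 0) :
    a ∈ Ideal.span (Set.range fun j : Fin n =>
      mk (p := p) (fun z => z j - p j) (analyticAt_coordinate_sub p j)) := by
  obtain ⟨g, hg, rfl⟩ := exists_eq_mk a
  rw [eval_mk] at ha
  obtain ⟨G, hG, he⟩ := hg.exists_eventually_eq_add_apply_sub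
  have hGj : ∀ j, AnalyticAt ℂ (fun z => G z (Pi.single j 1)) p := fun j =>
    ((ContinuousLinearMap.apply ℂ ℂ (Pi.single j (1 : ℂ) : Fin n → ℂ)).analyticAt _).comp hG
  have hterm : ∀ j, AnalyticAt ℂ (fun z => G z (Pi.single j 1) * (z j - p j)) p := fun j =>
    (hGj j).mul (analyticAt_coordinate_sub p j)
  have : mk g hg = ∑ j, mk _ (hGj j) *
      mk (p := p) (fun z => z j - p j) (analyticAt_coordinate_sub p j) := by
    refine Eq.trans ?_ (mk_sum Finset.univ _ hterm
      (Finset.univ.analyticAt_fun_sum fun j _ => hterm j))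
    refine mk_eq_mk ?_
    filter_upwards [he] with z hz
    rw [hz, ha, zero_add]
    conv_lhs => rw [← Finset.univ_sum_single (z - p), map_sum]
    refine Finset.sum_congr rfl fun j _ => ?_
    rw [mul_comm, ← smul_eq_mul, ← map_smul, ← Pi.single_smul, smul_eq_mul, mul_one, Pi.sub_apply]
  rw [this]
  exact Ideal.sum_mem _ fun j _ => Ideal.mul_mem_left _ _ (Ideal.subset_span ⟨j, rfl⟩)

end HoloGerm

/-! ### The maximal ideals of the local rings of an analytic space -/

namespace LogSpace

variable {X Y : LogSpace.{u}}

theorem LocalModel.isUnit_φ_iff {U : Opens X.carrier} (m : X.LocalModel U) (u : U)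
    (a : HoloGerm (m.i u)) : IsUnit (m.φ u a) ↔ HoloGerm.eval _ a ≠ 0 := by
  refine ⟨fun h h0 => ?_, fun h => (HoloGerm.isUnit_of_eval_ne_zero h).map _⟩
  obtain ⟨b, hb⟩ := h.exists_right_inv
  obtain ⟨b, rfl⟩ := m.φ_surjective u b
  -- The kernel of `φ` consists of germs vanishing at the point, since `u` lies on the zero set.
  have hker : RingHom.ker (m.φ u) ≤ RingHom.ker (HoloGerm.eval (m.i u)) := by
    rw [m.ker_φ, Ideal.span_le]
    rintro _ ⟨j, rfl⟩
    have : m.i u ∈ Set.range m.i := ⟨u, rfl⟩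
    rw [m.range_i] at this
    exact this.2 j
  have h1 : a * b - 1 ∈ RingHom.ker (m.φ u) := by
    rw [RingHom.mem_ker, map_sub, map_mul, hb, map_one, sub_self]
  have h2 := hker h1
  rw [RingHom.mem_ker, map_sub, map_mul, h0, zero_mul, map_one, zero_sub] at h2
  exact neg_ne_zero.2 one_ne_zero h2

/-- The coordinate functions of a local model, centred at `s`, generate the maximal ideal at `s`
and vanish simultaneously only at `s`. -/
theorem IsAnalytic.exists_generators_maximalIdeal (hX : X.IsAnalytic) (s : X.carrier) :
    ∃ (U : Opens X.carrier) (hs : s ∈ U) (n : ℕ) (σ : Fin n → ∀ x : U, X.O x),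
      (∀ j, X.sheafO.pred (σ j)) ∧
      IsLocalRing.maximalIdeal (X.O s) = Ideal.span (Set.range fun j => σ j ⟨s, hs⟩) ∧
      ∀ x : U, (∀ j, ¬ IsUnit (σ j x)) → x.1 = s := by
  obtain ⟨U, hs, ⟨m⟩⟩ := hX s
  let σ : Fin m.n → ∀ x : U, X.O x := fun j x =>
    m.φ x (HoloGerm.mk (fun z => z j - m.i ⟨s, hs⟩ j) (HoloGerm.analyticAt_coordinate_sub _ j))
  refine ⟨U, hs, m.n, σ, fun j => m.φ_mem U le_rfl _ _, le_antisymm ?_ ?_, fun x hx => ?_⟩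
  · intro a ha
    obtain ⟨a, rfl⟩ := m.φ_surjective ⟨s, hs⟩ a
    rw [IsLocalRing.mem_maximalIdeal, mem_nonunits_iff,
      m.isUnit_φ_iff ⟨s, hs⟩ a, not_not] at ha
    have := Ideal.mem_map_of_mem (m.φ ⟨s, hs⟩) (HoloGerm.mem_span_coordinates_of_eval_eq_zero ha)
    rw [Ideal.map_span, ← Set.range_comp] at this
    exact this
  · rw [Ideal.span_le]
    rintro _ ⟨j, rfl⟩
    rw [SetLike.mem_coe, IsLocalRing.mem_maximalIdeal, mem_nonunits_iff, m.isUnit_φ_iff, not_not,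
      HoloGerm.eval_mk, sub_self]
  · refine congrArg Subtype.val (m.isEmbedding_i.injective (a₁ := x) (a₂ := ⟨s, hs⟩) ?_)
    funext j
    have := hx j
    rwa [m.isUnit_φ_iff, not_not, HoloGerm.eval_mk, sub_eq_zero] at this

end LogSpace

/-! ### Charts and strict homomorphisms -/

theorem AmalgamatedSum.bijective_desc_iff {R P M : Type*} [CommMonoid R] [CommMonoid P]
    [CommMonoid M] (a : R →* P) (b : R →* Mˣ) (f : P →* M)
    (h : ∀ r, f (a r) = Units.coeHom M (b r)) :
    Function.Bijective (AmalgamatedSum.desc a b f (Units.coeHom M) h) ↔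
      (∀ m, ∃ (p : P) (u : Mˣ), m = f p * u) ∧
      ∀ (p p' : P) (u u' : Mˣ), f p * u = f p' * u' →
        ∃ r r', p * a r = p' * a r' ∧ u * b r' = u' * b r := by
  have hd : ∀ p u, AmalgamatedSum.desc a b f (Units.coeHom M) h
      ((p, u) : P × Mˣ) = f p * u := fun p u => rfl
  constructor
  · rintro ⟨h1, h2⟩
    refine ⟨fun m => ?_, fun p p' u u' e => ?_⟩
    · obtain ⟨x, rfl⟩ := h2 m
      induction x using Con.induction_on with | _ x
      exact ⟨x.1, x.2, rfl⟩
    · rw [← hd, ← hd] at e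
      exact amalgamCon_iff_of_group.1 ((Con.eq _).1 (h1 e))
  · rintro ⟨h1, h2⟩
    refine ⟨fun x y e => ?_, fun m => ?_⟩
    · induction x using Con.induction_on with | _ x
      induction y using Con.induction_on with | _ y
      exact (Con.eq _).2 (amalgamCon_iff_of_group.2 (h2 x.1 y.1 x.2 y.2 e))
    · obtain ⟨p, u, rfl⟩ := h1 m
      exact ⟨((p, u) : P × Mˣ), hd p u⟩

/-- The stalkwise condition in the definition of a strict morphism: `N` is the amalgamated sum
`M ⊕_{Mˣ} Nˣ`. -/
def IsStrictHom {M N : Type*} [CommMonoid M] [CommMonoid N] (φ : M →* N) : Prop :=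
  Function.Bijective (AmalgamatedSum.desc (Units.coeHom M) (Units.map φ) φ (Units.coeHom N)
    fun _ => rfl)

theorem isStrictHom_iff {M N : Type*} [CommMonoid M] [CommMonoid N] {φ : M →* N} :
    IsStrictHom φ ↔ (∀ n, ∃ (m : M) (u : Nˣ), n = φ m * u) ∧
      ∀ (m m' : M) (u u' : Nˣ), φ m * u = φ m' * u' →
        ∃ v v' : Mˣ, m * v = m' * v' ∧ u * Units.map φ v' = u' * Units.map φ v :=
  AmalgamatedSum.bijective_desc_iff _ _ _ _

theorem IsStrictHom.id (M : Type*) [CommMonoid M] : IsStrictHom (MonoidHom.id M) :=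
  isStrictHom_iff.2 ⟨fun m => ⟨m, 1, by simp⟩, fun m m' u u' h => ⟨u, u', h, mul_comm _ _⟩⟩

theorem IsStrictHom.bijective_associatesMap {M N : Type*} [CommMonoid M] [CommMonoid N]
    {φ : M →* N} (hφ : IsStrictHom φ) : Function.Bijective (associatesMap φ) := by
  obtain ⟨h1, h2⟩ := isStrictHom_iff.1 hφ
  constructor
  · rintro ⟨m⟩ ⟨m'⟩ h
    obtain ⟨u, hu⟩ : Associated (φ m) (φ m') := Quotient.exact h
    obtain ⟨v, v', h3, -⟩ := h2 m m' u 1 (by rw [hu, Units.val_one, mul_one])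
    refine Quotient.sound ⟨v * v'⁻¹, ?_⟩
    rw [Units.val_mul, ← mul_assoc, h3, Units.mul_inv_cancel_right]
  · rintro ⟨n⟩
    obtain ⟨m, u, rfl⟩ := h1 n
    exact ⟨Associates.mk m, Quotient.sound ⟨u, rfl⟩⟩

namespace LogSpace

variable {X Y : LogSpace.{u}}

theorem IsChartAt.comp_isStrictHom {P M N : Type*} [CommMonoid P] [CommMonoid M] [CommMonoid N]
    {b : P →* M} {φ : M →* N} (hb : IsChartAt b) (hφ : IsStrictHom φ) [IsLocalHom φ] :
    IsChartAt (φ.comp b) := by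
  obtain ⟨h1, h2⟩ := (AmalgamatedSum.bijective_desc_iff _ _ _ _).1 hb
  obtain ⟨h3, h4⟩ := isStrictHom_iff.1 hφ
  refine (AmalgamatedSum.bijective_desc_iff _ _ _ _).2 ⟨fun n => ?_, fun p p' u u' h => ?_⟩
  · obtain ⟨m, u, rfl⟩ := h3 n
    obtain ⟨p, v, rfl⟩ := h1 m
    exact ⟨p, Units.map φ v * u, by simp [mul_assoc]⟩
  · obtain ⟨v, v', h5, h6⟩ := h4 _ _ u u' h
    obtain ⟨⟨r, hr⟩, ⟨r', hr'⟩, h7, h8⟩ := h2 p p' v v' h5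
    refine ⟨⟨r, IsUnit.map φ hr⟩, ⟨r', IsUnit.map φ hr'⟩, h7, ?_⟩
    have h6 : (u : N) * φ v' = u' * φ v := congrArg Units.val h6
    have h8 : φ (v * b r') = φ (v' * b r) := congrArg (fun w => φ (Units.val w)) h8
    rw [map_mul, map_mul] at h8
    apply Units.ext
    change (u : N) * φ (b r') = u' * φ (b r)
    -- Cancel the unit `φ v * φ v'`.
    refine ((v.isUnit.map φ).mul (v'.isUnit.map φ)).mul_right_cancel ?_
    calc u * φ (b r') * (φ v * φ v') = (u * φ v') * (φ v * φ (b r')) := by ac_rfl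
      _ = (u' * φ v) * (φ v' * φ (b r)) := by rw [h6, h8]
      _ = u' * φ (b r) * (φ v * φ v') := by ac_rfl

/-- The homomorphism `α` reflects units because it is bijective over the units of `𝒪`. -/
theorem isUnit_of_isUnit_α {x : X.carrier} {m : X.M x} (h : IsUnit (X.α x m)) : IsUnit m := by
  obtain ⟨a, ha⟩ := h.exists_right_inv
  obtain ⟨m', hm', -⟩ := X.α_units x a (IsUnit.of_mul_eq_one _ ((mul_comm _ _).trans ha))
  refine IsUnit.of_mul_eq_one m' ?_
  refine (X.α_units x 1 isUnit_one).unique ?_ (map_one _)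
  rw [map_mul, hm', ha]

instance isLocalHom_mapM (f : X ⟶ Y) (x : X.carrier) : IsLocalHom (Hom.mapM f x) := by
  refine ⟨fun m hm => isUnit_of_isUnit_α ?_⟩
  have := hm.map (X.α x)
  rw [Hom.α_mapM] at this
  exact (Hom.isLocalHom_mapO f x).map_nonunit _ this

end LogSpace

/-! ### Strict immersions -/

theorem Ideal.span_range_fin_add {R : Type*} [CommRing R] {a b : ℕ} (F : Fin (a + b) → R) :
    Ideal.span (Set.range F) = Ideal.span (Set.range fun i => F (Fin.castAdd b i)) ⊔
      Ideal.span (Set.range fun i => F (Fin.natAdd a i)) := by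
  rw [← Ideal.span_union]
  congr 1
  ext x
  constructor
  · rintro ⟨i, rfl⟩
    induction i using Fin.addCases with
    | left i => exact Or.inl ⟨i, rfl⟩
    | right i => exact Or.inr ⟨i, rfl⟩
  · rintro (⟨i, rfl⟩ | ⟨i, rfl⟩) <;> exact ⟨_, rfl⟩

namespace LogSpace

variable {X Y : LogSpace.{u}}

/-- A strict immersion `j : Y → X` of finite presentation: `Y` carries the induced topology, `𝒪_Y`
is a quotient of `j⁻¹𝒪_X` by an ideal that is locally generated by finitely many sections of `𝒪_X`
having `Y` as common zero locus, and the log structure of `Y` is the pullback of that of `X`.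
Open subspaces and closed subspaces are covered alike. -/
structure IsStrictImmersion (j : Y ⟶ X) : Prop where
  isEmbedding : IsEmbedding (Hom.base j)
  surjective : ∀ y, Function.Surjective (Hom.mapO j y)
  isStrict : IsStrict j
  exists_generators : ∀ y, ∃ (W : Opens X.carrier) (_ : Hom.base j y ∈ W) (k : ℕ)
    (σ : Fin k → ∀ x : W, X.O x), (∀ i, X.sheafO.pred (σ i)) ∧
    (∀ x : W, (∀ i, ¬ IsUnit (σ i x)) → x.1 ∈ Set.range (Hom.base j)) ∧
    ∀ y' (h : Hom.base j y' ∈ W),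
      RingHom.ker (Hom.mapO j y') = Ideal.span (Set.range fun i => σ i ⟨Hom.base j y', h⟩)

theorem IsStrictImmersion.isFsLogStructure {j : Y ⟶ X} (hj : IsStrictImmersion j)
    (hX : X.IsFsLogStructure) : Y.IsFsLogStructure := by
  intro y
  obtain ⟨U, hU, P, _, b, hP, hb, hc⟩ := hX (Hom.base j y)
  exact ⟨U.comap (Hom.base j), hU, P, _, fun y' => (Hom.mapM j y'.1).comp (b ⟨_, y'.2⟩), hP,
    fun p => Hom.mapM_mem j U _ (hb p), fun y' =>
      (hc ⟨_, y'.2⟩).comp_isStrictHom (hj.isStrict y'.1)⟩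

/-- The zero locus of finitely many further equations in a local model is again a local model. -/
theorem IsStrictImmersion.isAnalytic {j : Y ⟶ X} (hj : IsStrictImmersion j)
    (hX : X.IsAnalytic) : Y.IsAnalytic := by
  intro y
  obtain ⟨U, hU, ⟨m⟩⟩ := hX (Hom.base j y)
  obtain ⟨W, hW, k, σ, hσ, hzero, hker⟩ := hj.exists_generators y
  let u₀ : U := ⟨Hom.base j y, hU⟩
  -- Lift the generators, near `j y`, to holomorphic functions `G i` on the ambient `ℂ^n`.
  have hlift : ∀ i, ∃ (G : (Fin m.n → ℂ) → ℂ) (hG : AnalyticAt ℂ G (m.i u₀)),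
      m.φ u₀ (HoloGerm.mk G hG) = σ i ⟨_, hW⟩ := by
    intro i
    obtain ⟨a, ha⟩ := m.φ_surjective u₀ (σ i ⟨_, hW⟩)
    obtain ⟨G, hG, rfl⟩ := HoloGerm.exists_eq_mk a
    exact ⟨G, hG, ha⟩
  choose G hG hGσ using hlift
  let D₁ : Set (Fin m.n → ℂ) := ⋂ i, {z | AnalyticAt ℂ (G i) z}
  have hD₁ : IsOpen D₁ := isOpen_iInter_of_finite fun i => isOpen_analyticAt ℂ (G i)
  have hopen : ∀ D : Set (Fin m.n → ℂ), IsOpen D →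
      IsOpen {x : X.carrier | ∃ h : x ∈ U, m.i ⟨x, h⟩ ∈ D} := by
    intro D hD
    convert U.isOpen.isOpenMap_subtype_val _ (hD.preimage m.isEmbedding_i.continuous) using 1
    ext x
    simp
  let U₁ : Opens X.carrier := ⟨_, hopen D₁ hD₁⟩
  have hU₁ : U₁ ≤ U := fun x hx => hx.1
  have hU₁' : ∀ x (hx : x ∈ U₁), ∀ i, AnalyticAt ℂ (G i) (m.i ⟨x, hU₁ hx⟩) := fun x hx i =>
    Set.mem_iInter.1 hx.2 i
  have hu₀ : u₀.1 ∈ U₁ := ⟨hU, Set.mem_iInter.2 hG⟩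
  have hnear : ∀ i, ∃ W' : Opens X.carrier, u₀.1 ∈ W' ∧ ∃ (iU : W' ≤ U₁) (iV : W' ≤ W),
      ∀ x (hx : x ∈ W'), m.φ ⟨x, hU₁ (iU hx)⟩ (HoloGerm.mk (G i) (hU₁' x (iU hx) i)) =
        σ i ⟨x, iV hx⟩ := fun i =>
    X.isStalkSheafO.eq_near u₀.1 U₁ W hu₀ hW _
      (m.φ_mem U₁ hU₁ (G i) fun u => hU₁' u.1 u.2 i) (σ i) (hσ i) (hGσ i)
  choose W' hW' iU iV heq using hnear
  -- On `W₀` the lifts represent the generators; the part of `U` over `D` lies in `W₀`.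
  let W₀ : Opens X.carrier := 
    ⟨⋂ i, W' i, isOpen_iInter_of_finite fun i => (W' i).isOpen⟩ ⊓ (U₁ ⊓ W)
  have hW₀ : u₀.1 ∈ W₀ := ⟨Set.mem_iInter.2 hW', hu₀, hW⟩
  have hW₀' : ∀ x ∈ W₀, ∀ i, x ∈ W' i := fun x hx => Set.mem_iInter.1 hx.1
  obtain ⟨D₂, hD₂, hD₂'⟩ := m.isEmbedding_i.isOpen_iff.1 (W₀.isOpen.preimage
    (continuous_subtype_val (p := fun x => x ∈ U)))
  have hD₂'' : ∀ u : U, m.i u ∈ D₂ ↔ u.1 ∈ W₀ := fun u => Set.ext_iff.1 hD₂' u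
  let D : Set (Fin m.n → ℂ) := m.D ∩ D₁ ∩ D₂
  have hD : IsOpen D := (m.isOpen_D.inter hD₁).inter hD₂
  let V₀ : Opens X.carrier := ⟨_, hopen D hD⟩
  let V : Opens Y.carrier := V₀.comap (Hom.base j)
  let q : V → U := fun v => ⟨Hom.base j v.1, v.2.1⟩
  have hqD : ∀ v : V, m.i (q v) ∈ D := fun v => v.2.2
  have hqW : ∀ v : V, Hom.base j v.1 ∈ W₀ := fun v => (hD₂'' _).1 (hqD v).2
  have hq : IsEmbedding q := (hj.isEmbedding.comp .subtypeVal).codRestrict _ _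
  have hmD : ∀ u, m.i u ∈ m.D := m.i_mem
  have hφG : ∀ (v : V) i, m.φ (q v) (HoloGerm.mk (G i) (Set.mem_iInter.1 (hqD v).1.2 i)) =
      σ i ⟨_, (hqW v).2.2⟩ := fun v i => heq i _ (hW₀' _ (hqW v) i)
  have hanal : ∀ i, AnalyticOnNhd ℂ ((Fin.append m.f G : _ → (Fin m.n → ℂ) → ℂ) i) D := by
    intro i
    induction i using Fin.addCases with
    | left i => rw [Fin.append_left]; exact fun z hz => m.analytic_f i z hz.1.1
    | right i => rw [Fin.append_right]; exact fun z hz => Set.mem_iInter.1 hz.1.2 i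
  refine ⟨V, ⟨hU, ⟨hmD _, Set.mem_iInter.2 hG⟩, (hD₂'' u₀).2 hW₀⟩, ⟨?_⟩⟩
  refine
    { n := m.n
      D := D
      isOpen_D := hD
      k := m.k + k
      f := Fin.append m.f G
      analytic_f := hanal
      i := fun v => m.i (q v)
      isEmbedding_i := m.isEmbedding_i.comp hq
      range_i := ?_
      i_mem := hqD
      φ := fun v => (Hom.mapO j v.1).toRingHom.comp (m.φ (q v))
      φ_const := fun v c => (congrArg (Hom.mapO j v.1) (m.φ_const (q v) c)).trans
        ((Hom.mapO j v.1).commutes c)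
      φ_mem := ?_
      φ_surjective := fun v => (hj.surjective v.1).comp (m.φ_surjective (q v))
      ker_φ := ?_ }
  · -- In `D`, the common zeros of the `G i` on `U` are the points of `Y`.
    have hzeroG : ∀ (u : U) (_ : m.i u ∈ D), (∀ i, G i (m.i u) = 0) ↔
        u.1 ∈ Set.range (Hom.base j) := by
      intro u hu
      have huW : u.1 ∈ W₀ := (hD₂'' u).1 hu.2
      have hval : ∀ i, ¬ IsUnit (σ i ⟨u.1, huW.2.2⟩) ↔ G i (m.i u) = 0 := by
        intro i
        rw [← heq i u.1 (hW₀' _ huW i), m.isUnit_φ_iff ⟨u.1, _⟩, not_not, HoloGerm.eval_mk]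
      constructor
      · intro h
        exact hzero ⟨u.1, huW.2.2⟩ fun i => (hval i).2 (h i)
      · rintro ⟨y', hy'⟩ i
        rw [← hval]
        obtain ⟨u, huU⟩ := u
        subst hy'
        intro hunit
        have h0 : σ i ⟨Hom.base j y', huW.2.2⟩ ∈ RingHom.ker (Hom.mapO j y') := by
          rw [hker y' huW.2.2]
          exact Ideal.subset_span ⟨i, rfl⟩
        have := hunit.map (Hom.mapO j y')
        rw [(RingHom.mem_ker).1 h0] at this
        exact not_isUnit_zero this
    ext z
    constructor
    · rintro ⟨v, rfl⟩
      refine ⟨hqD v, fun i => ?_⟩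
      induction i using Fin.addCases with
      | left i =>
        rw [Fin.append_left]
        have : m.i (q v) ∈ Set.range m.i := ⟨_, rfl⟩
        rw [m.range_i] at this
        exact this.2 i
      | right i =>
        rw [Fin.append_right]
        exact (hzeroG (q v) (hqD v)).2 ⟨v.1, rfl⟩ i
    · rintro ⟨hz, hf⟩
      have : z ∈ Set.range m.i := by
        rw [m.range_i]
        exact ⟨hz.1.1, fun i => by simpa using hf (Fin.castAdd k i)⟩
      obtain ⟨⟨x, hxU⟩, rfl⟩ := this
      obtain ⟨y', rfl⟩ := (hzeroG _ hz).1 fun i => by simpa using hf (Fin.natAdd m.k i)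
      exact ⟨⟨y', hxU, hz⟩, rfl⟩
  · -- `g` is analytic at the points over an open subset of `X`, not only at those of `Y`.
    intro U' hU' g hg
    let U₂ : Opens X.carrier := ⟨_, hopen _ (isOpen_analyticAt ℂ g)⟩
    have h1 := Hom.mapO_mem j U₂ _ (m.φ_mem U₂ (fun x hx => hx.1) g fun u => u.2.2)
    have h2 : U' ≤ U₂.comap (Hom.base j) := fun y' hy' => ⟨(hU' hy').1, hg ⟨y', hy'⟩⟩
    exact Y.sheafO.res (homOfLE h2) _ h1
  · intro v
    have h1 : RingHom.ker ((Hom.mapO j v.1).toRingHom.comp (m.φ (q v))) =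
        (RingHom.ker (Hom.mapO j v.1)).comap (m.φ (q v)) := rfl
    have h2 : RingHom.ker (Hom.mapO j v.1) = (Ideal.span (Set.range fun i =>
        HoloGerm.mk (G i) (Set.mem_iInter.1 (hqD v).1.2 i))).map (m.φ (q v)) := by
      rw [hker v.1 (hqW v).2.2, Ideal.map_span, ← Set.range_comp]
      exact congrArg (fun F => Ideal.span (Set.range F)) (funext fun i => (hφG v i).symm)
    rw [h1, h2, Ideal.comap_map_of_surjective _ (m.φ_surjective _), ← RingHom.ker_eq_comap_bot,
      m.ker_φ, sup_comm, Ideal.span_range_fin_add]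
    congr 4
    · funext i
      exact HoloGerm.mk_eq_mk (.of_eq (Fin.append_left m.f G i).symm)
    · funext i
      exact HoloGerm.mk_eq_mk (.of_eq (Fin.append_right m.f G i).symm)

theorem IsStrictImmersion.isFsLogAnalytic {j : Y ⟶ X} (hj : IsStrictImmersion j)
    (hX : X.IsFsLogAnalytic) : Y.IsFsLogAnalytic :=
  ⟨hj.isAnalytic hX.isAnalytic, hj.isFsLogStructure hX.isFs⟩

theorem isStrictImmersion_ι (X : LogSpace.{u}) (V : Opens X.carrier) :
    IsStrictImmersion (X.ι V) where
  isEmbedding := .subtypeVal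
  surjective _ := Function.surjective_id
  isStrict x := IsStrictHom.id (X.M x.1)
  exists_generators y := ⟨V, y.2, 0, fun i => i.elim0, fun i => i.elim0, fun x _ => ⟨x, rfl⟩,
    fun y' h => by
      rw [Set.range_eq_empty, Ideal.span_empty]
      exact (RingHom.injective_iff_ker_eq_bot (RingHom.id (X.O y'.1))).1 Function.injective_id⟩

end LogSpace

/-! ### The universal property of strict immersions -/

/-- Let `q` be stalkwise surjective and `G` be stalkwise maps such that `G ∘ q` carries sections of
`A` to sections of `C`; then `G` carries sections of `B` to sections of `C`, because the sections
of `B` are locally images of sections of `A`. -/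
theorem IsStalkSheaf.pred_of_comp_surjective {X Y T : TopCat.{u}} {j : C(Y, X)} {ℓ : C(T, Y)}
    {A : X → Type u} {B : Y → Type u} {C : T → Type u} {FA : TopCat.LocalPredicate A}
    {FB : TopCat.LocalPredicate B} {FC : TopCat.LocalPredicate C} (hA : IsStalkSheaf FA)
    (hB : IsStalkSheaf FB) {q : ∀ y, A (j y) → B y} (hq : ∀ y, Function.Surjective (q y))
    (hqmem : ∀ (V : Opens X) (s : ∀ x : V, A x), FA.pred s →
      FB.pred (fun y : V.comap j => q y (s ⟨j y, y.2⟩)))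
    {G : ∀ t, B (ℓ t) → C t}
    (hG : ∀ (V : Opens X) (s : ∀ x : V, A x), FA.pred s →
      FC.pred (fun t : V.comap (j.comp ℓ) => G t (q (ℓ t) (s ⟨j (ℓ t), t.2⟩))))
    (V : Opens Y) (s : ∀ y : V, B y) (hs : FB.pred s) :
    FC.pred (fun t : V.comap ℓ => G t (s ⟨ℓ t, t.2⟩)) := by
  apply FC.locality
  rintro ⟨t, ht⟩
  obtain ⟨a, ha⟩ := hq (ℓ t) (s ⟨ℓ t, ht⟩)
  obtain ⟨U, hU, σ, hσ, hσa⟩ := hA.exists_section (j (ℓ t)) a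
  obtain ⟨W, hW, iV, iU, e⟩ := hB.eq_near (ℓ t) V (U.comap j) ht hU s hs _ (hqmem U σ hσ)
    (by rw [hσa, ha])
  refine ⟨W.comap ℓ, hW, homOfLE fun t ht => iV ht, ?_⟩
  have h1 : W.comap ℓ ≤ U.comap (j.comp ℓ) := fun t ht => iU ht
  convert FC.res (homOfLE h1) _ (hG U σ hσ) using 2 with t
  exact congrArg (G t.1) (e (ℓ t.1) t.2)

theorem MonoidHom.exists_comp_eq_of_surjective {A B C : Type*} [CommMonoid A] [CommMonoid B]
    [CommMonoid C] {j : A →* B} (hj : Function.Surjective j) (F : A →* C)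
    (h : ∀ a a', j a = j a' → F a = F a') : ∃ G : B →* C, ∀ a, G (j a) = F a := by
  have key : ∀ a, F (Function.surjInv hj (j a)) = F a := fun a =>
    h _ _ (Function.surjInv_eq hj (j a))
  refine ⟨⟨⟨fun b => F (Function.surjInv hj b), ?_⟩, fun x y => ?_⟩, key⟩
  · rw [← map_one j, key, map_one]
  · obtain ⟨a, rfl⟩ := hj x
    obtain ⟨b, rfl⟩ := hj y
    change F (Function.surjInv hj (j a * j b)) =
      F (Function.surjInv hj (j a)) * F (Function.surjInv hj (j b))
    rw [← map_mul, key, key, key, map_mul]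

theorem AlgHom.exists_comp_eq_of_surjective {R A B C : Type*} [CommRing R] [CommRing A]
    [CommRing B] [CommRing C] [Algebra R A] [Algebra R B] [Algebra R C] {j : A →ₐ[R] B}
    (hj : Function.Surjective j) (F : A →ₐ[R] C) (h : RingHom.ker j ≤ RingHom.ker F) :
    ∃ G : B →ₐ[R] C, ∀ a, G (j a) = F a :=
  ⟨j.liftOfSurjective hj F h, fun _ => AlgHom.liftOfSurjective_apply ..⟩

namespace LogSpace

variable {X Y T : LogSpace.{u}}

/-- A unit of `M_Y` is the image of a unit of `M_X`, because it corresponds to a unit of `𝒪_Y`,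
which lifts to a unit of the local ring `𝒪_X`. -/
theorem surjective_mapM {j : Y ⟶ X} (hO : ∀ y, Function.Surjective (Hom.mapO j y))
    (hs : IsStrict j) (y : Y.carrier) : Function.Surjective (Hom.mapM j y) := by
  intro n
  obtain ⟨m, u, rfl⟩ := (isStrictHom_iff.1 (hs y)).1 n
  obtain ⟨a, ha⟩ := hO y (Y.α y u)
  have hunit : IsUnit a := (Hom.isLocalHom_mapO j y).map_nonunit a
    (ha ▸ u.isUnit.map (Y.α y))
  obtain ⟨v, hv, -⟩ := X.α_units _ a hunit
  refine ⟨m * v, ?_⟩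
  rw [map_mul]
  congr 1
  refine (Y.α_units y _ (u.isUnit.map (Y.α y))).unique ?_ rfl
  rw [Hom.α_mapM, hv, ha]

/-- The fibres of `M_X → M_Y` are the orbits of the units of `M_X` that become trivial in `M_Y`. -/
theorem exists_unit_of_mapM_eq {j : Y ⟶ X} (hs : IsStrict j) {y : Y.carrier}
    {a b : X.M (Hom.base j y)} (h : Hom.mapM j y a = Hom.mapM j y b) :
    ∃ v : (X.M (Hom.base j y))ˣ, a = b * v ∧ Hom.mapM j y v = 1 := by
  obtain ⟨v, v', h1, h2⟩ := (isStrictHom_iff.1 (hs y)).2 a b 1 1 (by rw [h])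
  rw [one_mul, one_mul] at h2
  refine ⟨v' * v⁻¹, ?_, ?_⟩
  · rw [Units.val_mul, ← mul_assoc, ← h1, Units.mul_inv_cancel_right]
  · change ((Units.map (Hom.mapM j y) (v' * v⁻¹) : (Y.M y)ˣ) : Y.M y) = 1
    rw [map_mul, h2, ← map_mul, mul_inv_cancel, map_one, Units.val_one]

/-- A strict morphism that is an embedding with surjective `j⁻¹𝒪_X → 𝒪_Y` is a monomorphism. -/
theorem eq_of_comp_eq {j : Y ⟶ X} (hb : Function.Injective (Hom.base j))
    (hO : ∀ y, Function.Surjective (Hom.mapO j y)) (hs : IsStrict j) {k k' : T ⟶ Y}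
    (h : k ≫ j = k' ≫ j) : k = k' := by
  obtain ⟨b, o, lo, ho, m, hm, am⟩ := k
  obtain ⟨b', o', lo', ho', m', hm', am'⟩ := k'
  obtain ⟨h1, h2, h3⟩ := Hom.ext_iff.1 h
  have hbb : b = b' := ContinuousMap.ext fun t => hb (DFunLike.congr_fun h1 t)
  subst hbb
  have h2 := eq_of_heq h2
  have h3 := eq_of_heq h3
  refine Hom.ext rfl (heq_of_eq ?_) (heq_of_eq ?_)
  · funext t
    refine AlgHom.ext fun a => ?_
    obtain ⟨a, rfl⟩ := hO _ a
    exact DFunLike.congr_fun (congrFun h2 t) a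
  · funext t
    refine MonoidHom.ext fun a => ?_
    obtain ⟨a, rfl⟩ := surjective_mapM hO hs _ a
    exact DFunLike.congr_fun (congrFun h3 t) a

/-- Let `j : Y → X` be a strict embedding whose ideal is given by ideals `J x` of the local rings
of `X`. A morphism to `X` factors through `j` if it maps to the range of `j` and kills `J`. -/
theorem exists_comp_eq {j : Y ⟶ X} (hb : IsEmbedding (Hom.base j))
    (hO : ∀ y, Function.Surjective (Hom.mapO j y)) (hs : IsStrict j) (J : ∀ x, Ideal (X.O x))
    (hJ : ∀ y, RingHom.ker (Hom.mapO j y) = J (Hom.base j y)) (F : T ⟶ X)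
    (hF : ∀ t, Hom.base F t ∈ Set.range (Hom.base j))
    (hFJ : ∀ t, J (Hom.base F t) ≤ RingHom.ker (Hom.mapO F t)) :
    ∃ k : T ⟶ Y, k ≫ j = F := by
  choose ℓ₀ hℓ₀ using hF
  let ℓ : C(T.carrier, Y.carrier) :=
    ⟨ℓ₀, hb.continuous_iff.2 (((Hom.base F).continuous).congr fun t => (hℓ₀ t).symm)⟩
  have hℓ : Hom.base F = (Hom.base j).comp ℓ := ContinuousMap.ext fun t => (hℓ₀ t).symm
  clear_value ℓ
  clear hℓ₀ ℓ₀
  obtain ⟨b, o, lo, ho, m, hm, am⟩ := F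
  dsimp only at hℓ hFJ
  subst hℓ
  have hO' : ∀ t, ∃ G : Y.O (ℓ t) →ₐ[ℂ] T.O t, ∀ a, G (Hom.mapO j (ℓ t) a) = o t a := fun t =>
    AlgHom.exists_comp_eq_of_surjective (hO (ℓ t)) (o t) ((hJ (ℓ t)).le.trans (hFJ t))
  choose G hG using hO'
  have hM' : ∀ t, ∃ H : Y.M (ℓ t) →* T.M t, ∀ a, H (Hom.mapM j (ℓ t) a) = m t a := by
    intro t
    refine MonoidHom.exists_comp_eq_of_surjective (surjective_mapM hO hs (ℓ t)) (m t) ?_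
    intro a a' haa
    obtain ⟨v, rfl, hv⟩ := exists_unit_of_mapM_eq hs haa
    have h0 : Hom.mapO j (ℓ t) (X.α _ (v : X.M (Hom.base j (ℓ t)))) = 1 := by
      rw [← Hom.α_mapM, hv, map_one]
    have h1 : o t (X.α _ (v : X.M (Hom.base j (ℓ t)))) = 1 :=
      (hG t _).symm.trans ((congrArg (G t) h0).trans (map_one _))
    have h2 : m t (v : X.M (Hom.base j (ℓ t))) = 1 :=
      (T.α_units t 1 isUnit_one).unique ((am t (v : X.M (Hom.base j (ℓ t)))).trans h1) (map_one _)
    exact (map_mul (m t) _ _).trans (by rw [h2, mul_one])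
  choose H hH using hM'
  let k : Hom T Y :=
    { base := ℓ
      mapO := G
      isLocalHom_mapO := fun t => ⟨fun y hy => by
        obtain ⟨a, rfl⟩ := hO _ y
        rw [hG] at hy
        exact ((lo t).map_nonunit a hy).map _⟩
      mapO_mem := X.isStalkSheafO.pred_of_comp_surjective Y.isStalkSheafO
        (q := fun y => Hom.mapO j y) hO (Hom.mapO_mem j) (G := fun t => G t) fun V s hs => by
          simp only [hG]
          exact ho V s hs
      mapM := H
      mapM_mem := X.isStalkSheafM.pred_of_comp_surjective Y.isStalkSheafM
        (q := fun y => Hom.mapM j y) (surjective_mapM hO hs) (Hom.mapM_mem j)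
        (G := fun t => H t) fun V s hs => by
          simp only [hH]
          exact hm V s hs
      α_mapM := fun t y => by
        obtain ⟨a, rfl⟩ := surjective_mapM hO hs _ y
        rw [hH, Hom.α_mapM, hG]
        exact am t a }
  refine ⟨k, Hom.ext rfl (heq_of_eq ?_) (heq_of_eq ?_)⟩
  · funext t
    exact AlgHom.ext (hG t)
  · funext t
    exact MonoidHom.ext (hH t)

end LogSpace

/-! ### The subspace defined by an ideal -/

/-- The sheaf on `Y` whose sections are locally the images, under the stalkwise maps `q`, of
sections of a sheaf `F` on `X`. -/
def imageSheaf {X Y : TopCat.{u}} {T : X → Type u} {T' : Y → Type u} (g : C(Y, X))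
    (q : ∀ y, T (g y) → T' y) (F : TopCat.LocalPredicate T) : TopCat.LocalPredicate T' where
  pred {U} s := ∀ x : U, ∃ (W : Opens X) (t : ∀ z : W, T z), F.pred t ∧
    ∃ (U' : Opens Y) (_ : x.1 ∈ U') (hU : U' ≤ U) (hW : ∀ y ∈ U', g y ∈ W),
      ∀ y (hy : y ∈ U'), s ⟨y, hU hy⟩ = q y (t ⟨g y, hW y hy⟩)
  res {U V} i s hs x := by
    obtain ⟨W, t, ht, U', hx, hU, hW, e⟩ := hs (i x)
    exact ⟨W, t, ht, U' ⊓ U, ⟨hx, x.2⟩, inf_le_right, fun y hy => hW y hy.1,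
      fun y hy => e y hy.1⟩
  locality {U} s hs x := by
    obtain ⟨V, hx, i, h⟩ := hs x
    obtain ⟨W, t, ht, U', hx', hU, hW, e⟩ := h ⟨x.1, hx⟩
    exact ⟨W, t, ht, U', hx', hU.trans i.le, hW, e⟩

section imageSheaf

variable {X Y : TopCat.{u}} {T : X → Type u} {T' : Y → Type u} {g : C(Y, X)}
  {q : ∀ y, T (g y) → T' y} {F : TopCat.LocalPredicate T}

theorem imageSheaf_pred_image (V : Opens X) (t : ∀ z : V, T z) (ht : F.pred t) :
    (imageSheaf g q F).pred (fun y : V.comap g => q y (t ⟨g y, y.2⟩)) := fun y =>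
  ⟨V, t, ht, V.comap g, y.2, le_rfl, fun _ h => h, fun _ _ => rfl⟩

theorem imageSheaf_pred_op {m : ∀ y, T y → T y → T y} {m' : ∀ y, T' y → T' y → T' y}
    (hq : ∀ y a b, q y (m _ a b) = m' y (q y a) (q y b))
    (hm : ∀ (U : Opens X) (s t : ∀ x : U, T x), F.pred s → F.pred t →
      F.pred fun x => m x (s x) (t x)) (U : Opens Y) (s t : ∀ y : U, T' y)
    (hs : (imageSheaf g q F).pred s) (ht : (imageSheaf g q F).pred t) :
    (imageSheaf g q F).pred fun y => m' y (s y) (t y) := by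
  intro x
  obtain ⟨W, a, ha, U', hx, hU, hW, e⟩ := hs x
  obtain ⟨W₂, b, hb, U₂, hx₂, hU₂, hW₂, e₂⟩ := ht x
  refine ⟨W ⊓ W₂, fun z => m z (a ⟨z, z.2.1⟩) (b ⟨z, z.2.2⟩), hm _ _ _
    (F.res (homOfLE inf_le_left) a ha) (F.res (homOfLE inf_le_right) b hb),
    U' ⊓ U₂, ⟨hx, hx₂⟩, inf_le_left.trans hU, fun y hy => ⟨hW y hy.1, hW₂ y hy.2⟩,
    fun y hy => ?_⟩
  rw [hq, ← e y hy.1, ← e₂ y hy.2]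

theorem isStalkSheaf_imageSheaf (hF : IsStalkSheaf F) (hq : ∀ y, Function.Surjective (q y))
    (hnear : ∀ (y : Y) (U : Opens X) (hy : g y ∈ U) (s t : ∀ x : U, T x), F.pred s → F.pred t →
      q y (s ⟨g y, hy⟩) = q y (t ⟨g y, hy⟩) →
      ∃ W : Opens X, g y ∈ W ∧ ∃ i : W ≤ U, ∀ y' (hy' : g y' ∈ W),
        q y' (s ⟨g y', i hy'⟩) = q y' (t ⟨g y', i hy'⟩)) :
    IsStalkSheaf (imageSheaf g q F) := by
  apply isStalkSheaf_of_germs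
  · intro y a
    obtain ⟨a, rfl⟩ := hq y a
    obtain ⟨U, hy, s, hs, rfl⟩ := hF.exists_section (g y) a
    exact ⟨U.comap g, hy, _, imageSheaf_pred_image U s hs, rfl⟩
  · intro x U V hU hV s hs t ht e
    obtain ⟨W₁, s', hs', U₁, hx₁, hU₁, hW₁, e₁⟩ := hs ⟨x, hU⟩
    obtain ⟨W₂, t', ht', U₂, hx₂, hU₂, hW₂, e₂⟩ := ht ⟨x, hV⟩
    obtain ⟨W, hW, i, e'⟩ := hnear x (W₁ ⊓ W₂) ⟨hW₁ x hx₁, hW₂ x hx₂⟩ _ _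
      (F.res (homOfLE inf_le_left) s' hs') (F.res (homOfLE inf_le_right) t' ht')
      ((e₁ x hx₁).symm.trans (e.trans (e₂ x hx₂)))
    refine ⟨U₁ ⊓ U₂ ⊓ W.comap g, ⟨⟨hx₁, hx₂⟩, hW⟩, fun y hy => hU₁ hy.1.1,
      fun y hy => hU₂ hy.1.2, fun y hy => ?_⟩
    exact (e₁ y hy.1.1).trans ((e' y hy.2).trans (e₂ y hy.1.2).symm)

end imageSheaf

namespace LogSpace

variable (X : LogSpace.{u}) {Z : Set X.carrier} {J : ∀ x, Ideal (X.O x)}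

/-- Near every point of `Z`, the ideal `J` is generated on `Z` by finitely many sections of `𝒪`
whose common zero locus is `Z`. -/
def IsZeroLocus (Z : Set X.carrier) (J : ∀ x, Ideal (X.O x)) : Prop :=
  ∀ x ∈ Z, ∃ (W : Opens X.carrier) (_ : x ∈ W) (k : ℕ) (σ : Fin k → ∀ x' : W, X.O x'),
    (∀ i, X.sheafO.pred (σ i)) ∧ (∀ x' : W, (∀ i, ¬ IsUnit (σ i x')) ↔ x'.1 ∈ Z) ∧
    ∀ x' : W, x'.1 ∈ Z → J x' = Ideal.span (Set.range fun i => σ i x')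

variable {X}

theorem IsZeroLocus.ne_top (hJ : X.IsZeroLocus Z J) {x : X.carrier} (hx : x ∈ Z) : J x ≠ ⊤ := by
  obtain ⟨W, hxW, k, σ, -, hZ, hspan⟩ := hJ x hx
  refine ne_top_of_le_ne_top (IsLocalRing.maximalIdeal.isMaximal (X.O x)).ne_top ?_
  rw [hspan ⟨x, hxW⟩ hx, Ideal.span_le]
  rintro _ ⟨i, rfl⟩
  exact (hZ ⟨x, hxW⟩).2 hx i

/-- A section whose germ at a point of `Z` lies in `J` lies in `J` at all nearby points of `Z`. -/
theorem IsZeroLocus.mem_near (hJ : X.IsZeroLocus Z J) {x : X.carrier} (hx : x ∈ Z)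
    (U : Opens X.carrier) (hU : x ∈ U) (s : ∀ y : U, X.O y) (hs : X.sheafO.pred s)
    (h : s ⟨x, hU⟩ ∈ J x) :
    ∃ W : Opens X.carrier, x ∈ W ∧ ∃ i : W ≤ U, ∀ y (hy : y ∈ W), y ∈ Z → s ⟨y, i hy⟩ ∈ J y := by
  have key : ∀ a ∈ J x, ∃ (V : Opens X.carrier) (hV : x ∈ V) (t : ∀ y : V, X.O y),
      X.sheafO.pred t ∧ t ⟨x, hV⟩ = a ∧ ∀ y : V, y.1 ∈ Z → t y ∈ J y := by
    obtain ⟨W, hxW, k, σ, hσ, -, hspan⟩ := hJ x hx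
    intro a ha
    rw [hspan ⟨x, hxW⟩ hx] at ha
    induction ha using Submodule.span_induction with
    | mem a ha =>
      obtain ⟨i, rfl⟩ := ha
      refine ⟨W, hxW, σ i, hσ i, rfl, fun y hy => ?_⟩
      rw [hspan y hy]
      exact Ideal.subset_span ⟨i, rfl⟩
    | zero =>
      exact ⟨⊤, trivial, _, X.const_mem ⊤ 0, map_zero _, fun y _ => by simp⟩
    | add a b _ _ iha ihb =>
      obtain ⟨V, hV, t, ht, rfl, htJ⟩ := iha
      obtain ⟨V', hV', t', ht', rfl, htJ'⟩ := ihb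
      exact ⟨V ⊓ V', ⟨hV, hV'⟩, _, X.add_mem _ _ _ (X.sheafO.res (homOfLE inf_le_left) t ht)
        (X.sheafO.res (homOfLE inf_le_right) t' ht'), rfl, fun y hy =>
        (J y).add_mem (htJ ⟨y, y.2.1⟩ hy) (htJ' ⟨y, y.2.2⟩ hy)⟩
    | smul c a _ iha =>
      obtain ⟨V, hV, t, ht, rfl, htJ⟩ := iha
      obtain ⟨V', hV', t', ht', rfl⟩ := X.isStalkSheafO.exists_section x c
      exact ⟨V' ⊓ V, ⟨hV', hV⟩, _, X.mul_mem _ _ _ (X.sheafO.res (homOfLE inf_le_left) t' ht')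
        (X.sheafO.res (homOfLE inf_le_right) t ht), rfl, fun y hy =>
        Ideal.mul_mem_left _ _ (htJ ⟨y, y.2.2⟩ hy)⟩
  obtain ⟨V, hV, t, ht, e, htJ⟩ := key _ h
  obtain ⟨W, hW, iU, iV, e'⟩ := X.isStalkSheafO.eq_near x U V hU hV s hs t ht e.symm
  exact ⟨W, hW, iU, fun y hy hyZ => by rw [e' y hy]; exact htJ ⟨y, iV hy⟩ hyZ⟩

/-- The congruence on `M_x` given by the units that are congruent to `1` modulo the ideal `I`. -/
def unitCon {x : X.carrier} (I : Ideal (X.O x)) : Con (X.M x) where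
  r a b := ∃ v : (X.M x)ˣ, X.α x v - 1 ∈ I ∧ a = b * v
  iseqv := by
    have hmul : ∀ v w : (X.M x)ˣ, X.α x v - 1 ∈ I → X.α x w - 1 ∈ I →
        X.α x (v * w : (X.M x)ˣ) - 1 ∈ I := fun v w hv hw => by
      have := I.add_mem (I.mul_mem_left (X.α x v) hw) hv
      rw [Units.val_mul, map_mul]
      convert this using 1
      ring
    refine ⟨fun a => ⟨1, by simp, by simp⟩, ?_, ?_⟩
    · rintro a b ⟨v, hv, rfl⟩
      refine ⟨v⁻¹, ?_, by simp⟩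
      have h1 : X.α x (v⁻¹ : (X.M x)ˣ) * X.α x v = 1 := by
        rw [← map_mul, Units.inv_mul, map_one]
      have := I.mul_mem_left (-X.α x (v⁻¹ : (X.M x)ˣ)) hv
      rw [neg_mul, mul_sub, h1, mul_one, neg_sub] at this
      exact this
    · rintro a b c ⟨v, hv, rfl⟩ ⟨w, hw, rfl⟩
      exact ⟨w * v, hmul w v hw hv, by rw [Units.val_mul, mul_assoc]⟩
  mul' := by
    rintro a b c d ⟨v, hv, rfl⟩ ⟨w, hw, rfl⟩
    refine ⟨v * w, ?_, by rw [Units.val_mul, mul_mul_mul_comm]⟩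
    have := I.add_mem (I.mul_mem_left (X.α x v) hw) hv
    rw [Units.val_mul, map_mul]
    convert this using 1
    ring

theorem isUnit_of_isUnit_mk {R : Type*} [CommRing R] [IsLocalRing R] {I : Ideal R} (hI : I ≠ ⊤)
    {a : R} (ha : IsUnit (Ideal.Quotient.mk I a)) : IsUnit a := by
  have := Ideal.Quotient.nontrivial_iff.2 hI
  exact (IsLocalHom.of_surjective (Ideal.Quotient.mk I) Ideal.Quotient.mk_surjective).map_nonunit
    a ha

/-- A unit of `M` has an inverse as a section on a neighbourhood. -/
theorem exists_unit_near (x : X.carrier) (v : (X.M x)ˣ) :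
    ∃ (W : Opens X.carrier) (hW : x ∈ W) (s : ∀ y : W, (X.M y)ˣ),
      X.sheafM.pred (fun y => (s y : X.M y)) ∧ s ⟨x, hW⟩ = v := by
  obtain ⟨U, hU, s, hs, hsx⟩ := X.isStalkSheafM.exists_section x v
  obtain ⟨V, hV, t, ht, htx⟩ := X.isStalkSheafM.exists_section x (v⁻¹ : (X.M x)ˣ)
  obtain ⟨W, hW, iU, iV, e⟩ := X.isStalkSheafM.eq_near x (U ⊓ V) ⊤ ⟨hU, hV⟩ trivial _
    (X.mul_memM _ _ _ (X.sheafM.res (homOfLE inf_le_left) s hs)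
      (X.sheafM.res (homOfLE inf_le_right) t ht)) _ (X.one_memM ⊤) (by
        change s ⟨x, hU⟩ * t ⟨x, hV⟩ = 1
        rw [hsx, htx, Units.mul_inv])
  have h1 : ∀ y : W, s ⟨y, (iU y.2).1⟩ * t ⟨y, (iU y.2).2⟩ = 1 := fun y => e y.1 y.2
  refine ⟨W, hW, fun y => ⟨_, _, h1 y, (mul_comm _ _).trans (h1 y)⟩,
    X.sheafM.res (homOfLE (iU.trans inf_le_left)) s hs, Units.ext hsx⟩

/-- The homomorphism `M_x / (1 + I) → 𝒪_x / I` induced by `α`. -/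
def quotientα {x : X.carrier} (I : Ideal (X.O x)) : (unitCon I).Quotient →* X.O x ⧸ I :=
  (unitCon I).lift ((Ideal.Quotient.mk I : X.O x →* X.O x ⧸ I).comp (X.α x)) fun a b h => by
    obtain ⟨v, hv, rfl⟩ : ∃ v : (X.M x)ˣ, X.α x v - 1 ∈ I ∧ a = b * v := h
    rw [Con.ker_rel, map_mul]
    have : Ideal.Quotient.mk I (X.α x v) = 1 := by
      rw [← map_one (Ideal.Quotient.mk I), Ideal.Quotient.mk_eq_mk_iff_sub_mem]
      exact hv
    simp [this]

/-- The subspace with underlying set `Z` and structure sheaf `𝒪_X / J`, with the log structure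
induced from that of `X`. -/
noncomputable def subspace (hJ : X.IsZeroLocus Z J) : LogSpace.{u} where
  carrier := TopCat.of Z
  O x := X.O x.1 ⧸ J x.1
  isLocalRingO x :=
    have := Ideal.Quotient.nontrivial_iff.2 (hJ.ne_top x.2)
    IsLocalRing.of_surjective' (Ideal.Quotient.mk (J x.1)) Ideal.Quotient.mk_surjective
  sheafO := imageSheaf (Y := TopCat.of Z) ⟨Subtype.val, continuous_subtype_val⟩
    (fun x => Ideal.Quotient.mk (J x.1)) X.sheafO
  isStalkSheafO := isStalkSheaf_imageSheaf X.isStalkSheafO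
    (fun x => Ideal.Quotient.mk_surjective) fun x U hx s t hs ht e => by
      have ht' := X.mul_mem U _ _ (X.const_mem U (-1)) ht
      obtain ⟨W, hW, i, h⟩ := hJ.mem_near x.2 U hx _ (X.add_mem U _ _ hs ht') (by
        have := (Ideal.Quotient.mk_eq_mk_iff_sub_mem _ _).1 e
        simpa [← sub_eq_add_neg] using this)
      refine ⟨W, hW, i, fun y hy => (Ideal.Quotient.mk_eq_mk_iff_sub_mem _ _).2 ?_⟩
      have := h y.1 hy y.2
      simpa [← sub_eq_add_neg] using this
  const_mem U c x := ⟨⊤, _, X.const_mem ⊤ c, U, x.2, le_rfl, fun _ _ => trivial, fun _ _ => rfl⟩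
  add_mem := imageSheaf_pred_op (Y := TopCat.of Z)
    (g := ⟨Subtype.val, continuous_subtype_val⟩)
    (q := fun x => Ideal.Quotient.mk (J x.1)) (m := fun _ a b => a + b) (m' := fun _ a b => a + b)
    (fun _ _ _ => map_add _ _ _) X.add_mem
  mul_mem := imageSheaf_pred_op (Y := TopCat.of Z)
    (g := ⟨Subtype.val, continuous_subtype_val⟩)
    (q := fun x => Ideal.Quotient.mk (J x.1)) (m := fun _ a b => a * b) (m' := fun _ a b => a * b)
    (fun _ _ _ => map_mul _ _ _) X.mul_mem
  M x := (unitCon (J x.1)).Quotient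
  sheafM := imageSheaf (Y := TopCat.of Z) ⟨Subtype.val, continuous_subtype_val⟩
    (fun x => (unitCon (J x.1)).mk') X.sheafM
  isStalkSheafM := isStalkSheaf_imageSheaf X.isStalkSheafM
    (fun x => Con.mk'_surjective) fun x U hx s t hs ht e => by
      obtain ⟨v, hv, hst⟩ := (Con.eq _).1 e
      obtain ⟨V, hV, w, hw, rfl⟩ := exists_unit_near x.1 v
      obtain ⟨W₁, hW₁, i₁, h₁⟩ := hJ.mem_near x.2 V hV _
        (X.add_mem V _ _ (X.α_mem V _ hw) (X.const_mem V (-1)))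
        (by simpa [← sub_eq_add_neg] using hv)
      obtain ⟨W₂, hW₂, i₂, i₃, h₂⟩ := X.isStalkSheafM.eq_near x.1 U (U ⊓ V) hx ⟨hx, hV⟩ s hs _
        (X.mul_memM (U ⊓ V) _ _ (X.sheafM.res (homOfLE inf_le_left) t ht)
          (X.sheafM.res (homOfLE inf_le_right) _ hw)) hst
      refine ⟨W₁ ⊓ W₂, ⟨hW₁, hW₂⟩, fun y hy => i₂ hy.2, fun y hy => (Con.eq _).2
        ⟨w ⟨y.1, i₁ hy.1⟩, ?_, h₂ y.1 hy.2⟩⟩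
      have := h₁ y.1 hy.1 y.2
      simpa [← sub_eq_add_neg] using this
  one_memM U x := ⟨⊤, _, X.one_memM ⊤, U, x.2, le_rfl, fun _ _ => trivial, fun _ _ => rfl⟩
  mul_memM := imageSheaf_pred_op (Y := TopCat.of Z)
    (g := ⟨Subtype.val, continuous_subtype_val⟩)
    (q := fun x => (unitCon (J x.1)).mk') (m := fun _ a b => a * b) (m' := fun _ a b => a * b)
    (fun _ _ _ => map_mul _ _ _) X.mul_memM
  α x := quotientα (J x.1)
  α_mem U s hs x := by
    obtain ⟨W, t, ht, U', hx, hU, hW, e⟩ := hs x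
    exact ⟨W, _, X.α_mem W t ht, U', hx, hU, hW, fun y hy => congrArg (quotientα (J y.1)) (e y hy)⟩
  α_units x a ha := by
    obtain ⟨a, rfl⟩ := Ideal.Quotient.mk_surjective a
    have ha' := isUnit_of_isUnit_mk (hJ.ne_top x.2) ha
    obtain ⟨m, hm, -⟩ := X.α_units x.1 a ha'
    refine ⟨(m : (unitCon (J x.1)).Quotient), congrArg (Ideal.Quotient.mk _) hm, fun m' hm' => ?_⟩
    subst hm
    induction m' using Con.induction_on with | _ m'
    have hm' : Ideal.Quotient.mk (J x.1) (X.α x.1 m') = Ideal.Quotient.mk _ (X.α x.1 m) := hm'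
    obtain ⟨v, rfl⟩ := isUnit_of_isUnit_α ha'
    obtain ⟨w, rfl⟩ := isUnit_of_isUnit_α (isUnit_of_isUnit_mk (hJ.ne_top x.2) (hm'.symm ▸ ha))
    refine (Con.eq _).2 ⟨v⁻¹ * w, ?_, by simp⟩
    have h1 : X.α x.1 (v⁻¹ : (X.M x.1)ˣ) * X.α x.1 v = 1 := by
      rw [← map_mul, Units.inv_mul, map_one]
    rw [Units.val_mul, map_mul, ← h1, ← mul_sub]
    exact Ideal.mul_mem_left _ _ ((Ideal.Quotient.mk_eq_mk_iff_sub_mem _ _).1 hm')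

/-- The inclusion of the subspace defined by an ideal. -/
noncomputable def subspaceι (hJ : X.IsZeroLocus Z J) : subspace hJ ⟶ X where
  base := ⟨Subtype.val, continuous_subtype_val⟩
  mapO := fun x : Z => Ideal.Quotient.mkₐ ℂ (J x.1)
  isLocalHom_mapO x := ⟨fun a h => isUnit_of_isUnit_mk (a := a) (hJ.ne_top (show Z from x).2) h⟩
  mapO_mem V s hs := imageSheaf_pred_image V s hs
  mapM := fun x : Z => (unitCon (J x.1)).mk'
  mapM_mem V s hs := imageSheaf_pred_image V s hs
  α_mapM _ _ := rfl

theorem ker_mapO_subspaceι (hJ : X.IsZeroLocus Z J) (z : (subspace hJ).carrier) :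
    RingHom.ker (Hom.mapO (subspaceι hJ) z) = J (Hom.base (subspaceι hJ) z) :=
  (Ideal.mk_ker : RingHom.ker (Ideal.Quotient.mk (J (Hom.base (subspaceι hJ) z))) = _)

theorem range_base_subspaceι (hJ : X.IsZeroLocus Z J) :
    Set.range (Hom.base (subspaceι hJ)) = Z :=
  Subtype.range_val

theorem isStrictHom_mk'_unitCon {x : X.carrier} {I : Ideal (X.O x)} (hI : I ≠ ⊤) :
    IsStrictHom (unitCon I).mk' := by
  -- Units of the quotient monoid lift to units.
  have hlift : ∀ u : ((unitCon I).Quotient)ˣ, ∃ v : (X.M x)ˣ,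
      ((v : X.M x) : (unitCon I).Quotient) = u := by
    intro u
    obtain ⟨m, hm⟩ := Con.mk'_surjective (u : (unitCon I).Quotient)
    have hu : IsUnit (quotientα I ((unitCon I).mk' m)) := (hm ▸ u.isUnit).map _
    obtain ⟨v, rfl⟩ := isUnit_of_isUnit_α (isUnit_of_isUnit_mk (a := X.α x m) hI hu)
    exact ⟨v, hm⟩
  refine isStrictHom_iff.2 ⟨fun n => ?_, fun m m' u u' h => ?_⟩
  · obtain ⟨m, rfl⟩ := Con.mk'_surjective n
    exact ⟨m, 1, by simp⟩
  · obtain ⟨v, hv⟩ := hlift u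
    obtain ⟨v', hv'⟩ := hlift u'
    rw [← hv, ← hv'] at h
    obtain ⟨w, hw, e⟩ : ∃ w : (X.M x)ˣ, X.α x w - 1 ∈ I ∧ m * v = m' * v' * w :=
      (Con.eq _).1 h
    have h1 : ((w : X.M x) : (unitCon I).Quotient) = 1 :=
      (Con.eq _).2 ⟨w, hw, (one_mul _).symm⟩
    refine ⟨v, v' * w, by rw [Units.val_mul, ← mul_assoc]; exact e, Units.ext ?_⟩
    rw [Units.val_mul, Units.val_mul, ← hv, ← hv', map_mul]
    change (v : (unitCon I).Quotient) * ((v' : X.M x) * (w : X.M x)) = v' * v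
    rw [h1, mul_one, mul_comm]

theorem isStrictImmersion_subspaceι (hJ : X.IsZeroLocus Z J) :
    IsStrictImmersion (subspaceι hJ) where
  isEmbedding := .subtypeVal
  surjective z a := (Ideal.Quotient.mk_surjective (I := J (Hom.base (subspaceι hJ) z)) a :)
  isStrict z := isStrictHom_mk'_unitCon (hJ.ne_top (show Z from z).2)
  exists_generators z := by
    obtain ⟨W, hW, k, σ, hσ, hZ, hspan⟩ := hJ (Hom.base (subspaceι hJ) z) (show Z from z).2
    refine ⟨W, hW, k, σ, hσ, fun x hx => ?_, fun z' hz' =>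
      (ker_mapO_subspaceι hJ z').trans (hspan ⟨_, hz'⟩ (show Z from z').2)⟩
    rw [range_base_subspaceι]
    exact (hZ x).1 hx

end LogSpace

/-! ### Maps on the quotients by units -/

theorem isProductOfDiagonals_comp_left_iff {P Q Q' : Type*} [CommMonoid P] [CommMonoid Q]
    [CommMonoid Q'] {h : P →* Q} {ψ : Q →* Q'} (hψ : Function.Bijective ψ) :
    IsProductOfDiagonals (ψ.comp h) ↔ IsProductOfDiagonals h := by
  let E := MulEquiv.ofBijective ψ hψ
  constructor
  · rintro ⟨r, s, e, e', H⟩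
    exact ⟨r, s, e, E.trans e', H⟩
  · rintro ⟨r, s, e, e', H⟩
    refine ⟨r, s, e, E.symm.trans e', fun p => ?_⟩
    have : E.symm (ψ.comp h p) = h p := E.symm_apply_apply (h p)
    rw [MulEquiv.trans_apply, this]
    exact H p

theorem isProductOfDiagonals_comp_right_iff {P P' Q : Type*} [CommMonoid P] [CommMonoid Q]
    [CommMonoid P'] {h : P →* Q} {φ : P' →* P} (hφ : Function.Bijective φ) :
    IsProductOfDiagonals (h.comp φ) ↔ IsProductOfDiagonals h := by
  let E := MulEquiv.ofBijective φ hφ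
  constructor
  · rintro ⟨r, s, e, e', H⟩
    refine ⟨r, s, E.symm.trans e, e', fun p => ?_⟩
    have : φ (E.symm p) = p := E.apply_symm_apply p
    have h1 := H (E.symm p)
    rwa [MonoidHom.comp_apply, this] at h1
  · rintro ⟨r, s, e, e', H⟩
    exact ⟨r, s, E.trans e, e', fun p => H (φ p)⟩

theorem isFreeMonoidOfFiniteRank_iff_of_bijective {P Q : Type*} [CommMonoid P] [CommMonoid Q]
    {φ : P →* Q} (hφ : Function.Bijective φ) :
    IsFreeMonoidOfFiniteRank P ↔ IsFreeMonoidOfFiniteRank Q := by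
  let E := MulEquiv.ofBijective φ hφ
  constructor
  · rintro ⟨r, ⟨e⟩⟩
    exact ⟨r, ⟨E.symm.trans e⟩⟩
  · rintro ⟨r, ⟨e⟩⟩
    exact ⟨r, ⟨E.trans e⟩⟩

namespace LogSpace

variable {X Y Z : LogSpace.{u}}

theorem IsStrict.bijective_mapMbar {f : X ⟶ Y} (hf : IsStrict f) (x : X.carrier) :
    Function.Bijective (mapMbar f x) :=
  IsStrictHom.bijective_associatesMap (hf x)

theorem mapMbar_comp (f : X ⟶ Y) (g : Y ⟶ Z) (x : X.carrier) :
    mapMbar (f ≫ g) x = (mapMbar f x).comp (mapMbar g (Hom.base f x)) := by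
  ext ⟨m⟩
  rfl

theorem bijective_mapMbar_of_eq_id {f : X ⟶ X} (hf : f = 𝟙 X) (x : X.carrier) :
    Function.Bijective (mapMbar f x) := by
  subst hf
  exact (IsStrictHom.id (X.M x)).bijective_associatesMap

theorem bijective_mapMbar_of_inverse {f : X ⟶ Y} {g : Y ⟶ X} (h₁ : f ≫ g = 𝟙 X)
    (h₂ : g ≫ f = 𝟙 Y) (x : X.carrier) : Function.Bijective (mapMbar f x) := by
  constructor
  · have h := (bijective_mapMbar_of_eq_id h₂ (Hom.base f x)).1
    rw [mapMbar_comp] at h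
    have h : Function.Injective (mapMbar f (Hom.base g (Hom.base f x))) :=
      Function.Injective.of_comp h
    have hx : Hom.base g (Hom.base f x) = x := congrArg (fun k => Hom.base k x) h₁
    rwa [hx] at h
  · have h := (bijective_mapMbar_of_eq_id h₁ x).2
    rw [mapMbar_comp] at h
    exact Function.Surjective.of_comp h

/-! ### Fibres over log points -/

variable {S : LogSpace.{u}}

/-- The ideal of `𝒪_X` generated by the maximal ideals of the points of `S`: on the fibre of `f`
over a point it is the ideal of that fibre. -/
def fibreIdeal (f : X ⟶ S) (x : X.carrier) : Ideal (X.O x) :=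
  (IsLocalRing.maximalIdeal (S.O (Hom.base f x))).map (Hom.mapO f x)

theorem isZeroLocus_fibreIdeal (hS : S.IsAnalytic) (f : X ⟶ S) (s : S.carrier) :
    X.IsZeroLocus (Hom.base f ⁻¹' {s}) (fibreIdeal f) := by
  intro x hx
  obtain ⟨U, hsU, n, σ, hσ, hspan, hzero⟩ := hS.exists_generators_maximalIdeal s
  have hspan' : ∀ t (ht : t ∈ U), t = s →
      IsLocalRing.maximalIdeal (S.O t) = Ideal.span (Set.range fun j => σ j ⟨t, ht⟩) := by
    rintro t ht rfl
    exact hspan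
  have hxU : x ∈ U.comap (Hom.base f) := by
    rw [Opens.mem_comap, show Hom.base f x = s from hx]
    exact hsU
  refine ⟨U.comap (Hom.base f), hxU, n, fun j y => Hom.mapO f y.1 (σ j ⟨Hom.base f y.1, y.2⟩),
    fun j => Hom.mapO_mem f U _ (hσ j), fun y => ⟨fun h => ?_, fun h j hj => ?_⟩, fun y hy => ?_⟩
  · exact hzero ⟨_, y.2⟩ fun j hj => h j (hj.map _)
  · have h1 := (Hom.isLocalHom_mapO f y.1).map_nonunit _ hj
    refine (IsLocalRing.mem_maximalIdeal _).1 ?_ h1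
    rw [hspan' _ y.2 h]
    exact Ideal.subset_span ⟨j, rfl⟩
  · rw [fibreIdeal, hspan' _ y.2 hy, Ideal.map_span, ← Set.range_comp]
    rfl

/-- The residue fields of an analytic space are `ℂ`. -/
theorem IsAnalytic.exists_sub_algebraMap_mem_maximalIdeal (hX : X.IsAnalytic) (x : X.carrier)
    (a : X.O x) : ∃ c : ℂ, a - algebraMap ℂ (X.O x) c ∈ IsLocalRing.maximalIdeal (X.O x) := by
  obtain ⟨U, hx, ⟨m⟩⟩ := hX x
  obtain ⟨a, rfl⟩ := m.φ_surjective ⟨x, hx⟩ a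
  refine ⟨HoloGerm.eval _ a, ?_⟩
  rw [← m.φ_const ⟨x, hx⟩, ← map_sub, IsLocalRing.mem_maximalIdeal, mem_nonunits_iff,
    m.isUnit_φ_iff ⟨x, hx⟩, not_not, map_sub, HoloGerm.eval_mk, sub_self]

end LogSpace

namespace FsLogAnalyticSpace

open LogSpace

variable {X S p Z : FsLogAnalyticSpace.{u}}

theorem IsLogPoint.surjective_mapO (hp : IsLogPoint p) (i : p ⟶ S) (x : p.toLogSpace.carrier) :
    Function.Surjective (Hom.mapO i x) := by
  intro a
  obtain ⟨c, rfl⟩ := (hp.bijective x).2 a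
  exact ⟨algebraMap ℂ _ c, (Hom.mapO i x).commutes c⟩

theorem IsLogPoint.ker_mapO (hp : IsLogPoint p) (i : p ⟶ S) (x : p.toLogSpace.carrier) :
    RingHom.ker (Hom.mapO i x) =
      IsLocalRing.maximalIdeal (S.toLogSpace.O (Hom.base i x)) := by
  refine le_antisymm (IsLocalRing.le_maximalIdeal (RingHom.ker_ne_top _)) fun a ha => ?_
  obtain ⟨c, hc⟩ := (hp.bijective x).2 (Hom.mapO i x a)
  rw [RingHom.mem_ker, ← hc]
  by_contra h0
  have hc0 : c ≠ 0 := by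
    rintro rfl
    exact h0 (map_zero _)
  have hu : IsUnit (Hom.mapO i x a) := hc ▸ hc0.isUnit.map (algebraMap ℂ _)
  exact ha ((Hom.isLocalHom_mapO i x).map_nonunit a hu)

/-- Every point of an fs log analytic space underlies a log point with the induced log structure. -/
theorem exists_isLogPoint (S : FsLogAnalyticSpace.{u}) (s : S.toLogSpace.carrier) :
    ∃ (p : FsLogAnalyticSpace.{u}) (i : p ⟶ S), IsLogPoint p ∧ IsStrict (log i) ∧
      s ∈ Set.range (Hom.base i) := by
  have hJ := isZeroLocus_fibreIdeal S.isFsLogAnalytic.isAnalytic (𝟙 S.toLogSpace) s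
  have himm := isStrictImmersion_subspaceι hJ
  refine ⟨⟨subspace hJ, himm.isFsLogAnalytic S.isFsLogAnalytic⟩, subspaceι hJ,
    ⟨⟨⟨s, rfl⟩⟩, ⟨?_⟩, fun z => ⟨?_, ?_⟩⟩, himm.isStrict, ⟨⟨s, rfl⟩, rfl⟩⟩
  · rintro ⟨x, hx⟩ ⟨y, hy⟩
    exact Subtype.ext (hx.trans hy.symm)
  · exact (algebraMap ℂ ((subspace hJ).O z)).injective
  · intro a
    obtain ⟨a, rfl⟩ := himm.surjective z a
    obtain ⟨c, hc⟩ :=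
      S.isFsLogAnalytic.isAnalytic.exists_sub_algebraMap_mem_maximalIdeal _ a
    refine ⟨c, ?_⟩
    have h1 : a - algebraMap ℂ _ c ∈ RingHom.ker (Hom.mapO (subspaceι hJ) z) := by
      rw [ker_mapO_subspaceι]
      exact Ideal.mem_map_of_mem (AlgHom.id ℂ _) hc
    rw [RingHom.mem_ker, map_sub, sub_eq_zero, AlgHom.commutes] at h1
    exact h1.symm

/-- The fibre of `f` over a log point with induced log structure is the subspace of `X` defined by
the fibre ideal; in particular it is strict over `X`. -/
theorem exists_isPullback (f : X ⟶ S) (i : p ⟶ S) (hp : IsLogPoint p) (hi : IsStrict (log i)) :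
    ∃ (Z : FsLogAnalyticSpace.{u}) (pr : Z ⟶ X) (g : Z ⟶ p), IsPullback pr g f i ∧
      IsStrict (log pr) ∧ Set.range (Hom.base pr) = Hom.base f ⁻¹' Set.range (Hom.base i) := by
  obtain ⟨o⟩ := hp.nonempty
  have := hp.subsingleton
  have hbase : ∀ z, Hom.base i z = Hom.base i o := fun z => congrArg _ (Subsingleton.elim z o)
  have hJ := isZeroLocus_fibreIdeal S.isFsLogAnalytic.isAnalytic f (Hom.base i o)
  have himm := isStrictImmersion_subspaceι hJ
  let Z : FsLogAnalyticSpace.{u} := ⟨subspace hJ, himm.isFsLogAnalytic X.isFsLogAnalytic⟩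
  let pr : Z ⟶ X := subspaceι hJ
  have hprJ : ∀ z, RingHom.ker (Hom.mapO pr z) = fibreIdeal f (Hom.base pr z) :=
    ker_mapO_subspaceι hJ
  have hprZ : ∀ z, Hom.base f (Hom.base pr z) = Hom.base i o := fun z => by
    have : Hom.base pr z ∈ Set.range (Hom.base pr) := ⟨z, rfl⟩
    rwa [range_base_subspaceι hJ] at this
  have hemb : IsEmbedding (Hom.base i) := .of_subsingleton _
  obtain ⟨g, hg⟩ : ∃ g : Z ⟶ p, g ≫ i = pr ≫ f := by
    refine exists_comp_eq (F := log pr ≫ log f) hemb (hp.surjective_mapO i) hi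
      (fun s => IsLocalRing.maximalIdeal (S.toLogSpace.O s)) (hp.ker_mapO i)
      (fun z => ⟨o, (hprZ z).symm⟩) fun z a ha => ?_
    change Hom.mapO pr z (Hom.mapO f _ a) = 0
    rw [← RingHom.mem_ker, hprJ]
    exact Ideal.mem_map_of_mem _ ha
  have hmono : ∀ {T : FsLogAnalyticSpace.{u}} {k k' : T ⟶ Z}, k ≫ pr = k' ≫ pr → k = k' :=
    fun h => eq_of_comp_eq himm.isEmbedding.injective himm.surjective himm.isStrict h
  have hmono' : ∀ {T : FsLogAnalyticSpace.{u}} {k k' : T ⟶ p}, k ≫ i = k' ≫ i → k = k' :=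
    fun h => eq_of_comp_eq hemb.injective (hp.surjective_mapO i) hi h
  have hsq : pr ≫ f = g ≫ i := hg.symm
  have hlift : ∀ {T : FsLogAnalyticSpace.{u}} (a : T ⟶ X) (b : T ⟶ p), a ≫ f = b ≫ i →
      ∃ k : T ⟶ Z, k ≫ pr = a := by
    intro T a b hab
    have hkill : ∀ F : T ⟶ S, F = b ≫ i → ∀ t,
        IsLocalRing.maximalIdeal (S.toLogSpace.O (Hom.base F t)) ≤
          RingHom.ker (Hom.mapO F t) := by
      rintro _ rfl t m hm
      change Hom.mapO b t (Hom.mapO i _ m) = 0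
      have : m ∈ RingHom.ker (Hom.mapO i (Hom.base b t)) := by
        rw [hp.ker_mapO]
        exact hm
      exact (congrArg (Hom.mapO b t) (RingHom.mem_ker.1 this)).trans (map_zero _)
    refine exists_comp_eq himm.isEmbedding himm.surjective himm.isStrict _ hprJ a
      (fun t => ?_) fun t => Ideal.map_le_iff_le_comap.2 fun m hm => hkill _ hab t hm
    rw [range_base_subspaceι hJ]
    have h1 : Hom.base f (Hom.base a t) = Hom.base i (Hom.base b t) :=
      congrArg (fun F => Hom.base F t) hab
    exact h1.trans (hbase _)
  refine ⟨Z, pr, g, ⟨⟨hsq⟩, ⟨Limits.PullbackCone.IsLimit.mk _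
    (fun c => (hlift c.fst c.snd c.condition).choose)
    (fun c => (hlift c.fst c.snd c.condition).choose_spec) (fun c => hmono' ?_)
    fun c k hk _ => hmono ?_⟩⟩, himm.isStrict, ?_⟩
  · rw [Category.assoc, ← hsq, ← Category.assoc,
      (hlift c.fst c.snd c.condition).choose_spec, c.condition]
  · rw [hk, (hlift c.fst c.snd c.condition).choose_spec]
  · refine (range_base_subspaceι hJ).trans (congrArg _ ?_)
    ext s
    constructor
    · rintro rfl
      exact ⟨o, rfl⟩
    · rintro ⟨z, rfl⟩
      exact hbase z

variable {f : X ⟶ S} {i : p ⟶ S} {pr : Z ⟶ X} {g : Z ⟶ p}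

theorem bijective_mapMbar_of_isPullback (hp : IsLogPoint p) (hi : IsStrict (log i))
    (h : IsPullback pr g f i) (z : Z.toLogSpace.carrier) :
    Function.Bijective (mapMbar (log pr) z) := by
  obtain ⟨Z', pr', g', h', hs, -⟩ := exists_isPullback f i hp hi
  let e := h.isoIsPullback _ _ h'
  have he : e.hom ≫ pr' = pr := h.isoIsPullback_hom_fst _ _ h'
  rw [← he]
  have h1 : mapMbar (log (e.hom ≫ pr')) z = _ := mapMbar_comp (log e.hom) (log pr') z
  rw [h1]
  exact (bijective_mapMbar_of_inverse (f := log e.hom) (g := log e.inv) e.hom_inv_id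
    e.inv_hom_id z).comp (hs.bijective_mapMbar _)

theorem isProductOfDiagonals_iff_of_isPullback (hp : IsLogPoint p) (hi : IsStrict (log i))
    (h : IsPullback pr g f i) (z : Z.toLogSpace.carrier) :
    IsProductOfDiagonals (mapMbar (log g) z) ↔
      IsProductOfDiagonals (mapMbar (log f) (Hom.base pr z)) := by
  have h1 := isProductOfDiagonals_comp_left_iff (h := mapMbar (log f) (Hom.base pr z))
    (bijective_mapMbar_of_isPullback hp hi h z)
  have h2 := isProductOfDiagonals_comp_right_iff (h := mapMbar (log g) z)
    (hi.bijective_mapMbar (Hom.base g z))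
  have hw : log pr ≫ log f = log g ≫ log i := h.w
  have hcongr : ∀ F G : Z.toLogSpace ⟶ S.toLogSpace, F = G →
      (IsProductOfDiagonals (mapMbar F z) ↔ IsProductOfDiagonals (mapMbar G z)) := by
    rintro F _ rfl
    exact Iff.rfl
  rw [← mapMbar_comp] at h1 h2
  exact h2.symm.trans ((hcongr _ _ hw).symm.trans h1)

/-- The restriction of an fs log analytic space to an open subset. -/
def restrict (T : FsLogAnalyticSpace.{u}) (V : Opens T.toLogSpace.carrier) :
    FsLogAnalyticSpace.{u} :=
  ⟨T.toLogSpace.restrict V, (isStrictImmersion_ι _ V).isFsLogAnalytic T.isFsLogAnalytic⟩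

/-- Log smoothness is stable under base change: a local lift to `X` induces one to the fibre
product, which applies since open subspaces of fs log analytic spaces are fs log analytic. -/
theorem IsLogSmooth.of_isPullback (hf : IsLogSmooth f) (h : IsPullback pr g f i) :
    IsLogSmooth g := by
  intro T₀ T j a b hj hab t
  obtain ⟨V, ht, k, hk₁, hk₂⟩ := hf T₀ T j (a ≫ pr) (b ≫ i) hj (by
    rw [Category.assoc, h.w, ← Category.assoc, hab, Category.assoc]) t
  let ιT : T.restrict V ⟶ T := T.toLogSpace.ι V
  let ιT₀ : T₀.restrict (V.comap (Hom.base j)) ⟶ T₀ := T₀.toLogSpace.ι _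
  let jV : T₀.restrict (V.comap (Hom.base j)) ⟶ T.restrict V := restrictHom (log j) V
  let k' : T.restrict V ⟶ X := k
  have hk₁' : k' ≫ f = (ιT ≫ b) ≫ i := hk₁
  have hk₂' : jV ≫ k' = (ιT₀ ≫ a) ≫ pr := hk₂
  have hι : jV ≫ ιT = ιT₀ ≫ j := restrictHom_comp_ι (log j) V
  have hres : jV ≫ h.lift k' (ιT ≫ b) hk₁' = ιT₀ ≫ a := by
    apply h.hom_ext
    · rw [Category.assoc, h.lift_fst, hk₂']
    · rw [Category.assoc, h.lift_snd, ← Category.assoc, hι, Category.assoc, ← hab,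
        Category.assoc]
  exact ⟨V, ht, h.lift k' (ιT ≫ b) hk₁', h.lift_snd _ _ _, hres⟩

/-! ### Semistable morphisms -/

theorem IsSemistable.isFree_and_isProductOfDiagonals (hf : IsSemistable f)
    (x : X.toLogSpace.carrier) :
    IsFreeMonoidOfFiniteRank (Associates (X.toLogSpace.M x)) ∧
      IsProductOfDiagonals (mapMbar (log f) x) := by
  obtain ⟨p, i, hp, hi, hs⟩ := exists_isLogPoint S (Hom.base f x)
  obtain ⟨Z, pr, g, h, -, hr⟩ := exists_isPullback f i hp hi
  obtain ⟨z, rfl⟩ : x ∈ Set.range (Hom.base pr) := by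
    rw [hr]
    exact hs
  have hZ := hf.fibre p Z i pr g hp hi h
  exact ⟨(isFreeMonoidOfFiniteRank_iff_of_bijective
      (bijective_mapMbar_of_isPullback hp hi h z)).2 (hZ.isFree z),
    (isProductOfDiagonals_iff_of_isPullback hp hi h z).1 (hZ.isProductOfDiagonals z)⟩

theorem isSemistable_iff :
    IsSemistable f ↔ IsVertical f ∧ IsSaturated f ∧ IsLogSmooth f ∧ IsFree X ∧ IsFree S := by
  constructor
  · intro hf
    exact ⟨fun x => (hf.isFree_and_isProductOfDiagonals x).2.isVerticalHom,
      fun x => (hf.isFree_and_isProductOfDiagonals x).2.isSaturatedHom, hf.isLogSmooth,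
      fun x => (hf.isFree_and_isProductOfDiagonals x).1, hf.isFree_base⟩
  · rintro ⟨hv, hs, hl, hX, hS⟩
    refine ⟨hl, hS, fun p Z i pr g hp hi h => ⟨hp, fun z => ?_, hl.of_isPullback h,
      fun z => ?_, fun z => ?_⟩⟩
    · exact (isFreeMonoidOfFiniteRank_iff_of_bijective
        (hi.bijective_mapMbar z)).1 (hS _)
    · exact (isFreeMonoidOfFiniteRank_iff_of_bijective
        (bijective_mapMbar_of_isPullback hp hi h z)).1 (hX _)
    · exact (isProductOfDiagonals_iff_of_isPullback hp hi h z).2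
        (isProductOfDiagonals_of_isVerticalHom_of_isSaturatedHom (hS _) (hX _) (hv _) (hs _))

end FsLogAnalyticSpace

theorem mainTheorem6 :
    (∀ {X S : FsLogAnalyticSpace.{u}} (f : X ⟶ S),
      FsLogAnalyticSpace.IsSemistable f ↔
        (FsLogAnalyticSpace.IsVertical f ∧ FsLogAnalyticSpace.IsSaturated f ∧
          FsLogAnalyticSpace.IsLogSmooth f ∧
          FsLogAnalyticSpace.IsFree X ∧ FsLogAnalyticSpace.IsFree S)) ∧
    (∀ (r m : ℕ) (h : Multiplicative (Fin r → ℕ) →* Multiplicative (Fin m → ℕ)), 1 ≤ r →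
      (IsIntegralHom h ↔
        ∃ (s : Fin r → ℕ) (d : ∀ i, ℕ →+ (Fin (s i) → ℕ)),
          m = ∑ i, s i ∧ IsIsoToProduct h s d)) :=
  ⟨fun _ => FsLogAnalyticSpace.isSemistable_iff,
    fun _ _ h hr => isIntegralHom_iff_exists_isIsoToProduct hr h⟩
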